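/- **The market.** A mixed economy $\mathcal M$ has a finite set $A$ of agents, a finite non-empty set $C$ of (divisible) conventional goods and a finite set $J$ of digital categories. Each category $j\in J$ starts with a finite non-empty set $S_j$ of songs; each song of $S_j$ is owned by one agent. A bundle or a production point is a vector in $\mathbb R_+^{C\cup J}$ (amounts of conventional goods, numbers of songs per category). - Each agent $i$ has a compact convex set $P_i\subset\mathbb R_+^{C\cup J}$ of feasible production points, and each conventional good can be produced in a positive amount by at least one agent. - Each agent $i$ has a coarse utility function $f_i:\mathbb R_+^{C\cup J}\to\mathbb R_+$ that is continuous, quasi-concave and non-satiated in each good: for every bundle $z$ and every $a\in C\cup J$ there is a bundle $z'$ with $z'_a>z_a$, $z'_b=z_b$ for $b\ne a$, and $f_i(z')>f_i(z)$. - For each category $j$, agent $i$ has a strict total order on the sellers $S_j\cup A$ (the initial songs, and the agents as producers of new songs). For a production $y=(y_i)_{i\in A}$ put $y_{kj}=1$ for $k\in S_j$, and $Y_j=\sum_{k\in S_j\cup A}y_{kj}$. If agent $i$ takes $q$ songs of category $j$ in the order of her ranking, she gets $\min\{y_{kj},\max(0,\,q-\sum_{k'\succ_{ij}k}y_{k'j})\}$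 from each seller $k\in S_j\cup A$. **Earnings.** Let $p$ be prices and let $x_{bjk}$ be what agent $b$ buys from seller $k$ of category $j$. Given $p$, $x$ and the productions of the other agents, agent $i$ earns from $y'\in P_i$ $$\sum_{c\in C}p_c\,y'_c+\sum_{j\in J}p_j\sum_{b\in A}\Big(\sum_{s\in S_j\text{ owned by }i}x_{bjs}+\min\Big\{y'_j,\ \max\Big(0,\ \sum_{k}x_{bjk}-\sum_{k\succ_{bj}i}y_{kj}\Big)\Big\}\Big):$$ the sales of her initial songs are those in the given allocation, and of the songs that she produces each agent $b$ buys as many as are left to buy after the sellers whom $b$ ranks above $i$. **Equilibrium with transfers.** Let $w=(w_i)_{i\in A}$, $w_i\ge0$. An equilibrium with wealth transfer function $w$ consists of prices $p\ge0$, a coarse allocation $z=(z_i)$, $z_i\in\mathbb R_+^{C\cup J}$, a detailed allocation $x$ and a production $y$ such that 1. $y_i\in P_i$, and $y_i$ maximizes agent $i$'s earnings over $P_i$, given $p$, $x$ and the productions of the other agents; moreover $\sum_i w_i$ is the sum of all agents' earnings; 2. $p\cdot z_i=w_i$, and $z_i$ maximizes $f_i$ over $\{z'\in\mathbb R_+^{C\cup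 J}: p\cdot z'\le w_i\}$; and $x_{ij\cdot}$ arises by taking $z_{ij}$ songs of category $j$ in the order of $i$'s ranking; 3. $\sum_i z_{ic}=\sum_i y_{ic}$ for all $c\in C$; for every $j\in J$ with $p_j>0$ and every $k\in S_j\cup A$ there is an agent $i$ with $x_{ijk}=y_{kj}$ (everything offered is bought in full by some agent); and $z_{ij}\le Y_j$ for all $i,j$. **Theorem (Second Welfare Theorem).** Let $(u_i)_{i\in A}$ be utilities attained in the restriction of $\mathcal M$ to the conventional economy: there are $y_i\in P_i$ and $z_i\in\mathbb R_+^{C\cup J}$, all with zero digital coordinates, such that $\sum_i z_{ic}=\sum_i y_{ic}$ for all $c\in C$ and $u_i=f_i(z_i)$ for all $i$. Suppose that $u_i>0$ for at least one $i$. Then there are a wealth transfer function $w$, a number $\alpha\ge1$ and an equilibrium with wealth transfer function $w$ in which every agent $i\in A$ has utility $\alpha\,u_i$. -/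

import Mathlib

noncomputable section

/-- A mixed economy with a finite set `A` of agents, a finite set `C` of conventional goods and a
finite set `J` of digital categories; `S j` is the set of songs initially present in category `j`.
Bundles and production points are vectors indexed by `C ⊕ J`. The sellers in category `j` are the
elements of `S j ⊕ A`: the initial songs, and the agents as producers of new songs. -/
structure MixedMarket (A C J : Type*) (S : J → Type*) where
  /-- the feasible production points of each agent -/
  production : A → Set (C ⊕ J → ℝ)
  production_nonneg : ∀ i, ∀ y ∈ production i, 0 ≤ y
  production_compact : ∀ i, IsCompact (production i)
  production_convex : ∀ i, Convex ℝ (production i)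
  /-- every conventional good can be produced in a positive amount (by at least one agent) -/
  producible : ∀ c : C, ∃ i, ∃ y ∈ production i, 0 < y (Sum.inl c)
  /-- the coarse utility functions; only their values on the nonnegative orthant matter -/
  utility : A → (C ⊕ J → ℝ) → ℝ
  utility_nonneg : ∀ i z, 0 ≤ z → 0 ≤ utility i z
  utility_continuous : ∀ i, ContinuousOn (utility i) {z | 0 ≤ z}
  utility_quasiconcave : ∀ i, QuasiconcaveOn ℝ {z | 0 ≤ z} (utility i)
  /-- non-satiation in each good: from any bundle, some larger amount of the good `a` alone, all
  other amounts unchanged, is strictly better -/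
  utility_nonsatiated : ∀ i z, 0 ≤ z → ∀ a : C ⊕ J, ∃ z' : C ⊕ J → ℝ,
    (∀ b, b ≠ a → z' b = z b) ∧ z a < z' a ∧ utility i z < utility i z'
  /-- the owner of each initial song -/
  owner : ∀ j, S j → A
  /-- `prefers i j k k'`: agent `i` ranks the seller `k` of category `j` strictly above `k'` -/
  prefers : ∀ (_ : A) (j : J), S j ⊕ A → S j ⊕ A → Prop
  prefers_total : ∀ i j, IsStrictTotalOrder (S j ⊕ A) (prefers i j)

namespace MixedMarket

variable {A C J : Type*} {S : J → Type*} [Fintype A] [Fintype C] [Fintype J]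
  [∀ j, Fintype (S j)]

/-- The number of songs available from seller `k` in category `j` under the production `y`:
one for an initial song, the number of songs produced for an agent. -/
def available (y : A → C ⊕ J → ℝ) (j : J) : S j ⊕ A → ℝ
  | Sum.inl _ => 1
  | Sum.inr k => y k (Sum.inr j)

open Classical in
/-- The number of songs of category `j` available from the sellers that agent `i` ranks strictly
above `k`. -/
def availableAbove (M : MixedMarket A C J S) (y : A → C ⊕ J → ℝ) (i : A) (j : J)
    (k : S j ⊕ A) : ℝ :=
  ∑ k' : S j ⊕ A, if M.prefers i j k' k then available y j k' else 0

/-- What agent `i` gets from seller `k` if she takes `q` songs of category `j` in the order of her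
ranking. -/
def detailed (M : MixedMarket A C J S) (y : A → C ⊕ J → ℝ) (i : A) (j : J) (q : ℝ)
    (k : S j ⊕ A) : ℝ :=
  min (available y j k) (max 0 (q - M.availableAbove y i j k))

open Classical in
/-- The earnings of agent `i` from the production point `y'`, at prices `p`, given the digital
allocation `x` and the productions `y` of the other agents. Her initial songs earn what they sell
in `x`. Of the `y' j` songs of category `j` that she produces, the buyer `b`, who gets
`∑ k, x b j k` songs in that category, buys as many as are left to buy after the sellers whom `b`
ranks above `i`. (The value does not depend on `y i`, as `i` is not ranked above herself.) -/
def earnings (M : MixedMarket A C J S) (p : C ⊕ J → ℝ) (x : A → ∀ j : J, S j ⊕ A → ℝ)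
    (y : A → C ⊕ J → ℝ) (i : A) (y' : C ⊕ J → ℝ) : ℝ :=
  ∑ c : C, p (Sum.inl c) * y' (Sum.inl c) +
  ∑ j : J, p (Sum.inr j) * ∑ b : A,
    ((∑ s : S j, if M.owner j s = i then x b j (Sum.inl s) else 0) +
      min (y' (Sum.inr j))
        (max 0 (∑ k : S j ⊕ A, x b j k - M.availableAbove y b j (Sum.inr i))))

/-- Equilibrium with wealth transfer function `w`: prices `p`, coarse allocation `z`, its digital
part in detail `x` (`x i j k` is what `i` buys from seller `k` in category `j`), production `y`. -/
structure IsEquilibriumWithTransfers (M : MixedMarket A C J S) (w : A → ℝ) (p : C ⊕ J → ℝ)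
    (z : A → C ⊕ J → ℝ) (x : A → ∀ j : J, S j ⊕ A → ℝ) (y : A → C ⊕ J → ℝ) : Prop where
  price_nonneg : 0 ≤ p
  /-- `w` redistributes the total earnings -/
  transfer_nonneg : 0 ≤ w
  transfer_sum : ∑ i, w i = ∑ i, M.earnings p x y i (y i)
  /-- production is feasible and optimizes the earnings -/
  production_mem : ∀ i, y i ∈ M.production i
  production_optimal : ∀ i, ∀ y' ∈ M.production i,
    M.earnings p x y i y' ≤ M.earnings p x y i (y i)
  /-- each agent spends `w i` on an optimal coarse allocation ... -/
  allocation_nonneg : ∀ i, 0 ≤ z i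
  allocation_spends : ∀ i, ∑ a, p a * z i a = w i
  allocation_optimal : ∀ i, ∀ z' : C ⊕ J → ℝ, 0 ≤ z' → ∑ a, p a * z' a ≤ w i →
    M.utility i z' ≤ M.utility i (z i)
  /-- ... and gets her songs in the order of her ranking -/
  allocation_detailed : ∀ i j k, x i j k = M.detailed y i j (z i (Sum.inr j)) k
  /-- the markets of the conventional goods clear -/
  conventional_clears : ∀ c : C, ∑ i, z i (Sum.inl c) = ∑ i, y i (Sum.inl c)
  /-- in a category with positive price, everything that each seller offers is bought in full by
  some agent -/
  digital_sold : ∀ j : J, 0 < p (Sum.inr j) → ∀ k : S j ⊕ A, ∃ i, x i j k = available y j k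
  /-- nobody wants more songs of a category than it has -/
  digital_available : ∀ i (j : J), z i (Sum.inr j) ≤ ∑ k : S j ⊕ A, available y j k

/-- The utilities `u` are attained in the restriction to the conventional economy: each agent
picks a feasible production point without digital goods, and what is produced is allocated. -/
def AttainedConventionally (M : MixedMarket A C J S) (u : A → ℝ) : Prop :=
  ∃ y z : A → C ⊕ J → ℝ,
    (∀ i, y i ∈ M.production i) ∧ (∀ i (j : J), y i (Sum.inr j) = 0) ∧
    (∀ i, 0 ≤ z i) ∧ (∀ i (j : J), z i (Sum.inr j) = 0) ∧
    (∀ c : C, ∑ i, z i (Sum.inl c) = ∑ i, y i (Sum.inl c)) ∧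
    ∀ i, u i = M.utility i (z i)

end MixedMarket

end

/-!
A quasi-equilibrium is a fixed point of a correspondence in which prices maximize the value of
excess demand, a common scale `α` of the utilities `u` minimizes it, every agent minimizes her
expenditure subject to the utility `α * u i`, and every producer maximizes her profit. Since all
agents can buy the same song, the demand for a digital category is the largest demand of an agent.
The profits suffice to pay for the conventional allocation, hence for the utilities `0 • u`, so the
value of excess demand is not positive, and the markets clear. Kakutani's theorem needs bounded
bundles, but as non-satiation is not local, a cheaper or better bundle may lie outside any given
box. The quasi-equilibria stay in a compact set as the box grows, so one of them works for every
box.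

There total wealth is positive, and an agent with positive wealth could improve for free if some
good were free. Hence all prices are positive, and minimizing expenditure amounts to maximizing
utility. The sales suffice to pay for the conventional allocation, which gives `1 ≤ α`.

Kakutani's theorem follows from Brouwer's by partitions of unity, and Brouwer's from Scarf's ordinal
pivoting on a grid in the simplex: if each grid point is coloured by a coordinate that the map does
not decrease, then there is a set of nearby points in which every coordinate is a colour or is
almost zero, so these points are almost fixed.
-/

open scoped Finset Matrix Topology

section OrdinalPivoting

variable {I X R : Type*} [LinearOrder R] {r : I → X → R} {B τ : Finset X} {x z : X} {a b i : I}

/-- Scarf's domination condition for the rankings `r`: for every `y` there is a ranking in which `y`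
is at most each element of `B`. -/
def IsDominating (r : I → X → R) (B : Finset X) : Prop :=
  ∀ y, ∃ i, IsMinOn (r i) B y

/-- The points that can be added to `τ` if the dominating element of the ranking `i` is to be
replaced: those that are below `τ` in no other ranking. -/
def pivotCandidates (r : I → X → R) (τ : Finset X) (i : I) : Set X :=
  {x | ∀ k, IsMinOn (r k) τ x → k = i}

theorem IsDominating.subset (hB : IsDominating r B) (hτ : τ ⊆ B) : IsDominating r τ := fun y =>
  (hB y).imp fun _ hy => hy.on_subset hτ

theorem eq_of_isMinOn (hr : ∀ i, Function.Injective (r i)) (hx : x ∈ τ) (hz : z ∈ τ)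
    (hxi : IsMinOn (r i) τ x) (hzi : IsMinOn (r i) τ z) : x = z :=
  hr i ((hxi hz).antisymm (hzi hx))

theorem exists_ne_isMinOn [Fintype I] (hτ : τ.Nonempty) (hcard : #τ < Fintype.card I) :
    ∃ a b, a ≠ b ∧ ∃ z ∈ τ, IsMinOn (r a) τ z ∧ IsMinOn (r b) τ z := by
  have hmin (i : I) : ∃ x ∈ τ, IsMinOn (r i) τ x := Finset.exists_min_image τ (r i) hτ
  choose m hmτ hm using hmin
  obtain ⟨a, -, b, -, hab, heq⟩ :=
    Finset.exists_ne_map_eq_of_card_lt_of_maps_to hcard fun i _ => hmτ i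
  exact ⟨a, b, hab, m a, hmτ a, hm a, heq ▸ hm b⟩

theorem IsDominating.index_unique [Fintype I] (hr : ∀ i, Function.Injective (r i))
    (hB : IsDominating r B) (hcard : #B = Fintype.card I) (hx : x ∈ B)
    (ha : IsMinOn (r a) B x) (hb : IsMinOn (r b) B x) : a = b := by
  choose index hindex using hB
  have hinj : Function.Injective fun y : B => index y := fun y z (hyz : index y = index z) =>
    Subtype.ext (eq_of_isMinOn hr y.2 z.2 (hindex y) (hyz ▸ hindex z))
  have hsurj := ((Fintype.bijective_iff_injective_and_card _).2 ⟨hinj, by simpa using hcard⟩).2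
  have index_eq {i : I} (hi : IsMinOn (r i) B x) : index x = i := by
    obtain ⟨y, rfl⟩ := hsurj i
    rw [eq_of_isMinOn hr hx y.2 hi (hindex y)]
  rw [← index_eq ha, index_eq hb]

theorem isMinOn_insert_of_not_isMinOn [DecidableEq X] {y : X} (hy : IsMinOn (r i) τ y)
    (hx : ¬ IsMinOn (r i) τ x) : IsMinOn (r i) (insert x τ : Finset X) y := by
  obtain ⟨t, ht, hlt⟩ : ∃ t ∈ τ, r i t < r i x := by simpa [isMinOn_iff] using hx
  rw [Finset.coe_insert, isMinOn_iff, Set.forall_mem_insert]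
  exact ⟨(hy ht).trans hlt.le, hy⟩

theorem isDominating_insert_of_isMaxOn [DecidableEq X] (hτ : IsDominating r τ)
    (hx : x ∈ pivotCandidates r τ i) (hmax : IsMaxOn (r i) (pivotCandidates r τ i) x) :
    IsDominating r (insert x τ) := by
  intro y
  by_cases hy : y ∈ pivotCandidates r τ i
  · obtain ⟨k, hk⟩ := hτ y
    obtain rfl := hy k hk
    refine ⟨k, ?_⟩
    rw [Finset.coe_insert, isMinOn_iff, Set.forall_mem_insert]
    exact ⟨hmax hy, hk⟩
  · obtain ⟨k, hk, hki⟩ : ∃ k, IsMinOn (r k) τ y ∧ k ≠ i := by simpa [pivotCandidates] using hy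
    exact ⟨k, isMinOn_insert_of_not_isMinOn hk (mt (hx k) hki)⟩

theorem notMem_of_mem_pivotCandidates (hr : ∀ i, Function.Injective (r i))
    (hτ : IsDominating r τ) (hab : a ≠ b) (hz : z ∈ τ) (ha : IsMinOn (r a) τ z)
    (hb : IsMinOn (r b) τ z) (hx : x ∈ pivotCandidates r τ a) : x ∉ τ := by
  intro hxτ
  obtain ⟨k, hk⟩ := hτ x
  obtain rfl := hx k hk
  obtain rfl := eq_of_isMinOn hr hxτ hz hk ha
  exact hab (hx b hb).symm

theorem exists_isMaxOn_pivotCandidates [Fintype I] [DecidableEq X]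
    (hr : ∀ i, Function.Injective (r i)) (hcard : #τ + 1 = Fintype.card I) (hab : a ≠ b)
    (hz : z ∈ τ) (ha : IsMinOn (r a) τ z) (hb : IsMinOn (r b) τ z) (hx : x ∉ τ)
    (hdom : IsDominating r (insert x τ)) :
    ∃ i, (i = a ∨ i = b) ∧ x ∈ pivotCandidates r τ i ∧
      IsMaxOn (r i) (pivotCandidates r τ i) x := by
  have hcard' : #(insert x τ) = Fintype.card I := by rw [Finset.card_insert_of_notMem hx, hcard]
  have hsub : (τ : Set X) ⊆ (insert x τ : Finset X) := Finset.subset_insert x τ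
  obtain ⟨i, hi⟩ := hdom x
  have hxi : x ∈ pivotCandidates r τ i := fun k hk =>
    hdom.index_unique hr hcard' (Finset.mem_insert_self x τ)
      (by rw [Finset.coe_insert, isMinOn_iff, Set.forall_mem_insert]; exact ⟨le_rfl, hk⟩) hi
  refine ⟨i, ?_, hxi, fun y hy => ?_⟩
  · by_contra! hne
    have hmin {k : I} (hki : k ≠ i) (hk : IsMinOn (r k) τ z) :=
      isMinOn_insert_of_not_isMinOn hk (mt (hxi k) hki)
    exact hab (hdom.index_unique hr hcard' (Finset.mem_insert_of_mem hz) (hmin hne.1.symm ha)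
      (hmin hne.2.symm hb))
  · obtain ⟨k, hk⟩ := hdom y
    obtain rfl := hy k (hk.on_subset hsub)
    exact hk (Finset.mem_insert_self x τ)

-- With fewer points than rankings, some `z ∈ τ` is the lowest point of `τ` in two rankings `a ≠ b`.
-- A point that can complete `τ` must be the best candidate for `a` or for `b`.
open Classical in
theorem card_isDominating_covBy_eq_two [Fintype I] [Fintype X]
    (hr : ∀ i, Function.Injective (r i)) (hτ : IsDominating r τ) (hne : τ.Nonempty)
    (hcard : #τ + 1 = Fintype.card I) (hE : ∀ i, (pivotCandidates r τ i).Nonempty) :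
    #{B | τ ⋖ B ∧ IsDominating r B} = 2 := by
  obtain ⟨a, b, hab, z, hz, ha, hb⟩ := exists_ne_isMinOn (r := r) hne (by lia)
  have hmax (i : I) := Set.exists_max_image _ (r i) (Set.toFinite (pivotCandidates r τ i)) (hE i)
  choose t ht htmax using hmax
  have hta : t a ∉ τ := notMem_of_mem_pivotCandidates hr hτ hab hz ha hb (ht a)
  have htb : t b ∉ τ := notMem_of_mem_pivotCandidates hr hτ hab.symm hz hb ha (ht b)
  have htab : t a ≠ t b := by
    intro h
    obtain ⟨k, hk⟩ := hτ (t a)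
    exact hab ((ht a k hk).symm.trans (ht b k (h ▸ hk)))
  have hpair : ({B | τ ⋖ B ∧ IsDominating r B} : Finset (Finset X)) =
      {insert (t a) τ, insert (t b) τ} := by
    ext B
    simp only [Finset.mem_filter_univ, Finset.mem_insert, Finset.mem_singleton,
      Finset.covBy_iff_exists_insert]
    constructor
    · rintro ⟨⟨x, hx, rfl⟩, hdom⟩
      obtain ⟨i, hi, hxi, hxmax⟩ := exists_isMaxOn_pivotCandidates hr hcard hab hz ha hb hx hdom
      obtain rfl : x = t i := hr i ((htmax i x hxi).antisymm (hxmax (ht i)))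
      exact hi.imp (congrArg fun k => insert (t k) τ) (congrArg fun k => insert (t k) τ)
    · rintro (rfl | rfl)
      · exact ⟨⟨t a, hta, rfl⟩, isDominating_insert_of_isMaxOn hτ (ht a) (htmax a)⟩
      · exact ⟨⟨t b, htb, rfl⟩, isDominating_insert_of_isMaxOn hτ (ht b) (htmax b)⟩
  rw [hpair, Finset.card_pair]
  exact fun h => htab ((Finset.insert_inj hta).1 h)

end OrdinalPivoting

section Scarf

theorem image_erase_eq_image_erase_iff {I X : Type*} [DecidableEq I] [DecidableEq X]
    {B : Finset X} {c : X → I} {x z : X} (hx : x ∈ B) (hz : z ∈ B) (hxz : x ≠ z) (hc : c z = c x)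
    (hinj : Set.InjOn c (B.erase x)) {w : X} (hw : w ∈ B) :
    (B.erase w).image c = (B.erase x).image c ↔ w = x ∨ w = z := by
  constructor
  · intro himage
    by_contra! hne
    have hwx : w ∈ B.erase x := Finset.mem_erase.2 ⟨hne.1, hw⟩
    obtain ⟨v, hv, hvw⟩ := Finset.mem_image.1 (himage ▸ Finset.mem_image_of_mem c hwx)
    obtain ⟨hvne, hvB⟩ := Finset.mem_erase.1 hv
    rcases eq_or_ne v x with rfl | hvx
    · exact hne.2 (hinj hwx (Finset.mem_erase.2 ⟨hxz.symm, hz⟩) (hc.trans hvw).symm)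
    · exact hvne (hinj (Finset.mem_erase.2 ⟨hvx, hvB⟩) hwx hvw)
  · rintro (rfl | rfl)
    · rfl
    · have image_erase {v v' : X} (hv' : v' ∈ B) (hne : v ≠ v') :
          (B.erase v).image c = insert (c v') (((B.erase v).erase v').image c) := by
        rw [← Finset.image_insert, Finset.insert_erase (Finset.mem_erase.2 ⟨hne.symm, hv'⟩)]
      rw [image_erase hx hxz.symm, image_erase hz hxz, hc, Finset.erase_right_comm]

open Classical in
theorem even_card_covBy_image_eq_compl {I X : Type*} [Fintype I] [DecidableEq I] [Fintype X]
    {B : Finset X} {c : X → I} (hcard : #B = Fintype.card I) (hB : B.image c ≠ Finset.univ)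
    (i₀ : I) : Even #{τ | τ ⋖ B ∧ τ.image c = {i₀}ᶜ} := by
  rcases Finset.eq_empty_or_nonempty ({τ | τ ⋖ B ∧ τ.image c = {i₀}ᶜ} : Finset (Finset X)) with
    hempty | ⟨τ, hτ⟩
  · simp [hempty]
  obtain ⟨hcov, himage⟩ := (Finset.mem_filter_univ _).1 hτ
  obtain ⟨x, hx, rfl⟩ := Finset.covBy_iff_exists_erase.1 hcov
  have hinj : Set.InjOn c (B.erase x) := Finset.card_image_iff.1 <| by
    rw [himage, Finset.card_compl, Finset.card_singleton, ← hcard, Finset.card_erase_of_mem hx]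
  have hcx : c x ∈ (B.erase x).image c := by
    rw [himage, Finset.mem_compl, Finset.mem_singleton]
    rintro rfl
    apply hB
    rw [← Finset.insert_erase hx, Finset.image_insert, himage, Finset.insert_compl_self]
  obtain ⟨z, hz, hzx⟩ := Finset.mem_image.1 hcx
  obtain ⟨hzx', hzB⟩ := Finset.mem_erase.1 hz
  have hpair : ({τ | τ ⋖ B ∧ τ.image c = {i₀}ᶜ} : Finset (Finset X)) =
      {B.erase x, B.erase z} := by
    have himage_iff {w : X} := image_erase_eq_image_erase_iff (w := w) hx hzB hzx'.symm hzx hinj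
    ext τ
    simp only [Finset.mem_filter_univ, Finset.mem_insert, Finset.mem_singleton,
      Finset.covBy_iff_exists_erase, ← himage]
    constructor
    · rintro ⟨⟨w, hw, rfl⟩, hτ⟩
      exact ((himage_iff hw).1 hτ).imp (congrArg B.erase) (congrArg B.erase)
    · rintro (rfl | rfl)
      · exact ⟨⟨x, hx, rfl⟩, rfl⟩
      · exact ⟨⟨z, hzB, rfl⟩, (himage_iff hzB).2 (Or.inr rfl)⟩
  rw [hpair, Finset.card_pair fun h => hzx'.symm ((Finset.erase_inj B hx).1 h)]
  exact even_two

variable {I T R : Type*}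

/-- The extension of the rankings `r` of `T` by slack points `inr k`: in the ranking `i` the slack
point `inr i` is at the bottom, and the others are above all of `T`. -/
def slackRank [DecidableEq I] (r : I → T → R) (i : I) : T ⊕ I → WithBot (R ⊕ₗ I)
  | .inl t => WithBot.some (Sum.inlₗ (r i t))
  | .inr k => if k = i then ⊥ else WithBot.some (Sum.inrₗ k)

variable [LinearOrder I] {r : I → T → R} {i k : I} {t : T}

theorem slackRank_inl : slackRank r i (.inl t) = WithBot.some (Sum.inlₗ (r i t)) := rfl

theorem slackRank_inr_self : slackRank r i (.inr i) = ⊥ := if_pos rfl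

theorem slackRank_inr_of_ne (h : k ≠ i) : slackRank r i (.inr k) = WithBot.some (Sum.inrₗ k) :=
  if_neg h

theorem slackRank_injective (hr : ∀ i, Function.Injective (r i)) (i : I) :
    Function.Injective (slackRank r i) := by
  rintro (t | k) (t' | k') h
  · simpa [slackRank_inl, (hr i).eq_iff] using h
  · simp only [slackRank] at h; split_ifs at h <;> simp at h
  · simp only [slackRank] at h; split_ifs at h <;> simp at h
  · simp only [slackRank] at h; split_ifs at h <;> simp_all

variable [LinearOrder R]

theorem slackRank_inl_lt_inr (h : k ≠ i) : slackRank r i (.inl t) < slackRank r i (.inr k) := by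
  simp [slackRank_inr_of_ne h, slackRank_inl, WithBot.coe_lt_coe]

theorem inr_notMem_of_isMinOn {B : Finset (T ⊕ I)} (h : IsMinOn (slackRank r i) B (.inl t)) :
    .inr i ∉ B := by
  intro hi
  simpa [slackRank_inr_self, slackRank_inl] using h hi

theorem inr_mem_pivotCandidates {τ : Finset (T ⊕ I)} (ht : .inl t ∈ τ) :
    .inr i ∈ pivotCandidates (slackRank r) τ i := by
  intro k hk
  by_contra! hki
  exact (hk ht).not_gt (slackRank_inl_lt_inr hki.symm)

/-- The extension of a colouring of `T` that gives the slack point `inr k` the colour `k`. -/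
def slackColour (c : T → I) : T ⊕ I → I := Sum.elim c id

/-- The set of all slack points but `inr i₀`. -/
def slackFace [Fintype I] (T : Type*) (i₀ : I) : Finset (T ⊕ I) := Finset.disjSum ∅ {i₀}ᶜ

variable [Fintype I] {i₀ : I} {B τ : Finset (T ⊕ I)} {c : T → I}

theorem inr_mem_slackFace : .inr k ∈ slackFace T i₀ ↔ k ≠ i₀ := by simp [slackFace]

theorem inl_notMem_slackFace : Sum.inl t ∉ slackFace T i₀ := by simp [slackFace]

theorem card_slackFace_add_one : #(slackFace T i₀) + 1 = Fintype.card I := by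
  have := Fintype.card_pos_iff.2 ⟨i₀⟩
  rw [slackFace, Finset.card_disjSum, Finset.card_empty, Finset.card_compl, Finset.card_singleton]
  lia

theorem image_slackColour_slackFace : (slackFace T i₀).image (slackColour c) = {i₀}ᶜ := by
  ext k
  simp [slackFace, slackColour]

theorem slackFace_covBy_iff [DecidableEq T] :
    slackFace T i₀ ⋖ B ↔
      (∃ t, insert (.inl t) (slackFace T i₀) = B) ∨ insert (.inr i₀) (slackFace T i₀) = B := by
  simp [Finset.covBy_iff_exists_insert, Sum.exists, inl_notMem_slackFace, inr_mem_slackFace]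

theorem exists_isMinOn_of_isDominating_slackRank (hB : IsDominating (slackRank r) B)
    (hc : B.image (slackColour c) = Finset.univ) (t : T) :
    ∃ s ∈ B.toLeft, IsMinOn (r (c s)) B.toLeft t := by
  obtain ⟨i, hi⟩ := hB (.inl t)
  obtain ⟨s | k, hs, hsi⟩ := Finset.mem_image.1 (hc ▸ Finset.mem_univ i)
  · obtain rfl : c s = i := hsi
    refine ⟨s, Finset.mem_toLeft.2 hs, fun s' hs' => ?_⟩
    simpa [slackRank_inl] using hi (Finset.mem_toLeft.1 hs')
  · obtain rfl : k = i := hsi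
    exact absurd hs (inr_notMem_of_isMinOn hi)

theorem isDominating_insert_inl_slackFace_iff [DecidableEq T] :
    IsDominating (slackRank r) (insert (Sum.inl t) (slackFace T i₀)) ↔ ∀ s, r i₀ s ≤ r i₀ t := by
  constructor
  · intro hdom s
    obtain ⟨i, hi⟩ := hdom (.inl s)
    obtain rfl : i = i₀ := by simpa [inr_mem_slackFace] using inr_notMem_of_isMinOn hi
    simpa [slackRank_inl] using hi (Finset.mem_insert_self (Sum.inl t) _)
  · rintro hmax (s | k)
    · refine ⟨i₀, ?_⟩
      rw [Finset.coe_insert, isMinOn_iff, Set.forall_mem_insert, Sum.forall]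
      refine ⟨?_, fun _ h => absurd h inl_notMem_slackFace, fun k hk => ?_⟩
      · simpa [slackRank_inl] using hmax s
      · exact (slackRank_inl_lt_inr (inr_mem_slackFace.1 hk)).le
    · exact ⟨k, fun x _ => by simp [slackRank_inr_self]⟩

theorem not_isDominating_insert_inr_slackFace [DecidableEq T] [Nonempty T] :
    ¬ IsDominating (slackRank r) (insert (Sum.inr i₀) (slackFace T i₀)) := by
  intro hdom
  obtain ⟨i, hi⟩ := hdom (.inl (Classical.arbitrary T))
  refine inr_notMem_of_isMinOn hi ?_
  rw [Finset.mem_insert, inr_mem_slackFace, Sum.inr.injEq]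
  exact em _

open Classical in
theorem card_isDominating_covBy_slackFace [Fintype T] [Nonempty T]
    (hr : ∀ i, Function.Injective (r i)) :
    #{B | slackFace T i₀ ⋖ B ∧ IsDominating (slackRank r) B} = 1 := by
  obtain ⟨t, ht⟩ := Finite.exists_max (r i₀)
  refine Finset.card_eq_one.2 ⟨insert (.inl t) (slackFace T i₀), ?_⟩
  ext B
  rw [Finset.mem_filter_univ, Finset.mem_singleton, slackFace_covBy_iff]
  constructor
  · rintro ⟨⟨s, rfl⟩ | rfl, hB⟩
    · obtain rfl := hr i₀ ((ht s).antisymm (isDominating_insert_inl_slackFace_iff.1 hB t))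
      rfl
    · exact absurd hB not_isDominating_insert_inr_slackFace
  · rintro rfl
    exact ⟨Or.inl ⟨t, rfl⟩, isDominating_insert_inl_slackFace_iff.2 ht⟩

theorem exists_inl_mem_of_ne_slackFace (hτ : τ.image (slackColour c) = {i₀}ᶜ)
    (hcard : #τ + 1 = Fintype.card I) (hne : τ ≠ slackFace T i₀) : ∃ t, .inl t ∈ τ := by
  by_contra! hinl
  refine hne (Finset.eq_of_subset_of_card_le ?_ ?_)
  · rintro (t | k) hk
    · exact absurd hk (hinl t)
    · have : k ∈ ({i₀}ᶜ : Finset I) := hτ ▸ Finset.mem_image_of_mem (slackColour c) hk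
      rw [inr_mem_slackFace]
      simpa using this
  · have := card_slackFace_add_one (T := T) (i₀ := i₀)
    lia

theorem isDominating_slackFace : IsDominating (slackRank r) (slackFace T i₀) := by
  rintro (t | k)
  · refine ⟨i₀, ?_⟩
    rintro (s | k) hk
    · exact absurd hk inl_notMem_slackFace
    · exact (slackRank_inl_lt_inr (inr_mem_slackFace.1 hk)).le
  · exact ⟨k, fun x _ => by simp [slackRank_inr_self]⟩

open Classical in
theorem odd_card_isDominating_covBy_iff [Fintype T] [Nonempty T]
    (hr : ∀ i, Function.Injective (r i)) (hdom : IsDominating (slackRank r) τ)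
    (hcard : #τ + 1 = Fintype.card I) (hτ : τ.image (slackColour c) = {i₀}ᶜ) :
    Odd #{B | τ ⋖ B ∧ IsDominating (slackRank r) B} ↔ τ = slackFace T i₀ := by
  constructor
  · contrapose!
    intro hne
    obtain ⟨t, ht⟩ := exists_inl_mem_of_ne_slackFace hτ hcard hne
    rw [card_isDominating_covBy_eq_two (slackRank_injective hr) hdom ⟨_, ht⟩ hcard
      fun i => ⟨_, inr_mem_pivotCandidates ht⟩]
    exact Nat.not_odd_iff_even.2 even_two
  · rintro rfl
    rw [card_isDominating_covBy_slackFace hr]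
    exact odd_one

open Classical in
/-- Double counting of the pairs `τ ⋖ B`, where `B` is a dominating set of `card I` points, and `τ`
a dominating set of `card I - 1` points with all colours but `i₀`: the number of such `B` is odd
for only one `τ`, hence some `B` contains an odd number of such `τ`. -/
theorem exists_isDominating_slackRank_image_eq_univ [Finite T] [Nonempty T] [Nonempty I]
    (hr : ∀ i, Function.Injective (r i)) (c : T → I) :
    ∃ B, IsDominating (slackRank r) B ∧ B.image (slackColour c) = Finset.univ := by
  obtain ⟨_⟩ := nonempty_fintype T
  obtain ⟨i₀⟩ := ‹Nonempty I›
  by_contra! hnot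
  let rooms : Finset (Finset (T ⊕ I)) := {B | IsDominating (slackRank r) B ∧ #B = Fintype.card I}
  let doors : Finset (Finset (T ⊕ I)) :=
    {τ | IsDominating (slackRank r) τ ∧ #τ + 1 = Fintype.card I ∧ τ.image (slackColour c) = {i₀}ᶜ}
  have card_eq {τ B : Finset (T ⊕ I)} (h : τ ⋖ B) : #τ + 1 = #B :=
    Nat.covBy_iff_add_one_eq.1 h.card_finset
  have heven : ∀ B ∈ rooms, Even #(doors.bipartiteBelow (· ⋖ ·) B) := by
    intro B hB
    obtain ⟨hdom, hcard⟩ := (Finset.mem_filter_univ _).1 hB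
    convert even_card_covBy_image_eq_compl hcard (hnot B hdom) i₀ using 2
    ext τ
    simp only [doors, Finset.mem_bipartiteBelow, Finset.mem_filter_univ]
    exact ⟨fun h => ⟨h.2, h.1.2.2⟩,
      fun h => ⟨⟨hdom.subset h.1.le, (card_eq h.1).trans hcard, h.2⟩, h.1⟩⟩
  have hodd : ∀ τ ∈ doors, Odd #(rooms.bipartiteAbove (· ⋖ ·) τ) ↔ τ = slackFace T i₀ := by
    intro τ hτ
    obtain ⟨hdom, hcard, himage⟩ := (Finset.mem_filter_univ _).1 hτ
    rw [← odd_card_isDominating_covBy_iff hr hdom hcard himage]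
    congr! 2
    ext B
    simp only [rooms, Finset.mem_bipartiteAbove, Finset.mem_filter_univ]
    exact ⟨fun h => ⟨h.2, h.1.1⟩, fun h => ⟨⟨h.2, (card_eq h.1).symm.trans hcard⟩, h.1⟩⟩
  have houter : slackFace T i₀ ∈ doors := (Finset.mem_filter_univ _).2
    ⟨isDominating_slackFace, card_slackFace_add_one, image_slackColour_slackFace⟩
  refine Nat.not_odd_iff_even.2 (Finset.even_sum _ heven) ?_
  rw [← Finset.sum_card_bipartiteAbove_eq_sum_card_bipartiteBelow, Finset.odd_sum_iff_odd_card_odd,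
    Finset.filter_congr hodd, Finset.filter_eq' doors, if_pos houter]
  exact odd_one

theorem exists_finset_isMinOn_colour {I T R : Type*} [Finite I] [LinearOrder R] [Finite T]
    [Nonempty T] {r : I → T → R} (hr : ∀ i, Function.Injective (r i)) (c : T → I) :
    ∃ σ : Finset T, ∀ t, ∃ s ∈ σ, IsMinOn (r (c s)) σ t := by
  obtain ⟨_⟩ := nonempty_fintype I
  have : Nonempty I := ‹Nonempty T›.map c
  let _ : LinearOrder I := LinearOrder.lift' _ (Fintype.equivFin I).injective
  obtain ⟨B, hB, hc⟩ := exists_isDominating_slackRank_image_eq_univ hr c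
  exact ⟨B.toLeft, exists_isMinOn_of_isDominating_slackRank hB hc⟩

end Scarf

section Brouwer

variable {I : Type*} [Fintype I] [Nonempty I] {m : ℕ}

theorem exists_finset_grid_dominating {P : (I → ℕ) → I → Prop}
    (hP : ∀ s, ∑ i, s i = m → ∃ i, P s i) :
    ∃ σ : Finset (I → ℕ), (∀ s ∈ σ, ∑ i, s i = m) ∧
      ∀ y : I → ℕ, ∑ i, y i = m → ∃ i, (∃ s ∈ σ, P s i) ∧ ∀ s ∈ σ, y i ≤ s i := by
  classical
  have mem_grid {s : I → ℕ} : s ∈ Finset.piAntidiag Finset.univ m ↔ ∑ i, s i = m := by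
    simp [Finset.mem_piAntidiag]
  let T := Finset.piAntidiag (Finset.univ : Finset I) m
  have : Nonempty T := ⟨⟨Pi.single (Classical.arbitrary I) m, mem_grid.2 (by simp)⟩⟩
  choose c hc using fun s : T => hP s (mem_grid.1 s.2)
  -- ties in the coordinate `i` are broken by an enumeration of the grid
  let rank : I → T → ℕ ×ₗ Fin (Fintype.card T) := fun i s => toLex (s.1 i, Fintype.equivFin T s)
  have hrank (i : I) : Function.Injective (rank i) := fun s t h =>
    (Fintype.equivFin T).injective (Prod.ext_iff.1 (toLex.injective h)).2
  obtain ⟨σ, hσ⟩ := exists_finset_isMinOn_colour hrank c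
  refine ⟨σ.map (Function.Embedding.subtype _), fun s hs => ?_, fun y hy => ?_⟩
  · obtain ⟨t, -, rfl⟩ := Finset.mem_map.1 hs
    exact mem_grid.1 t.2
  · obtain ⟨t, ht, hmin⟩ := hσ ⟨y, mem_grid.2 hy⟩
    refine ⟨c t, ⟨t, Finset.mem_map_of_mem _ ht, hc t⟩, fun s hs => ?_⟩
    obtain ⟨s', hs', rfl⟩ := Finset.mem_map.1 hs
    exact Prod.Lex.monotone_fst _ _ (hmin hs')

theorem lt_sum_add_one_of_forall_exists_le {C : Finset I} {l : I → ℕ}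
    (h : ∀ y : I → ℕ, ∑ i, y i = m → ∃ i ∈ C, y i ≤ l i) : m < ∑ i ∈ C, (l i + 1) := by
  classical
  by_contra! hle
  let y : I → ℕ := fun i => (if i ∈ C then l i + 1 else 0) +
    if i = Classical.arbitrary I then m - ∑ i ∈ C, (l i + 1) else 0
  have hy : ∑ i, y i = m := by
    rw [Finset.sum_add_distrib, Finset.sum_ite_mem, Finset.univ_inter,
      Finset.sum_ite_eq' Finset.univ, if_pos (Finset.mem_univ _), Nat.add_sub_cancel' hle]
  obtain ⟨i, hi, hyi⟩ := h y hy
  simp only [y, if_pos hi] at hyi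
  lia

theorem exists_finset_grid_close {P : (I → ℕ) → I → Prop}
    (hP : ∀ s, ∑ i, s i = m → ∃ i, P s i) :
    ∃ σ : Finset (I → ℕ), σ.Nonempty ∧ (∀ s ∈ σ, ∑ i, s i = m) ∧
      (∀ s ∈ σ, ∀ t ∈ σ, ∀ i, s i ≤ t i + Fintype.card I) ∧
      ∀ i, (∃ s ∈ σ, P s i) ∨ ∀ s ∈ σ, s i ≤ Fintype.card I := by
  classical
  obtain ⟨σ, hσm, hσ⟩ := exists_finset_grid_dominating hP
  have hne : σ.Nonempty := by
    obtain ⟨i, ⟨s, hs, -⟩, -⟩ := hσ (Pi.single (Classical.arbitrary I) m) (by simp)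
    exact ⟨s, hs⟩
  let C : Finset I := {i | ∃ s ∈ σ, P s i}
  let l : I → ℕ := fun i => if i ∈ C then σ.inf' hne (· i) else 0
  have hlσ (s) (hs : s ∈ σ) : l ≤ s := by
    intro i
    dsimp only [l]
    split_ifs
    · exact Finset.inf'_le _ hs
    · exact Nat.zero_le _
  have hlC : m < ∑ i ∈ C, (l i + 1) := lt_sum_add_one_of_forall_exists_le fun y hy => by
    obtain ⟨i, hi, hyi⟩ := hσ y hy
    have hiC : i ∈ C := (Finset.mem_filter_univ _).2 hi
    exact ⟨i, hiC, by simpa only [l, if_pos hiC] using Finset.le_inf' hne (· i) hyi⟩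
  have hsum : m ≤ ∑ i, l i + Fintype.card I := by
    have h1 := Finset.sum_le_sum_of_subset (f := fun i => l i + 1) (Finset.subset_univ C)
    rw [Finset.sum_add_distrib (s := Finset.univ), Finset.sum_const, Finset.card_univ, smul_eq_mul,
      mul_one] at h1
    exact hlC.le.trans h1
  have hupper (s) (hs : s ∈ σ) (i) : s i ≤ l i + Fintype.card I := by
    have h1 := Finset.sum_le_sum fun k (_ : k ∈ Finset.univ.erase i) => hlσ s hs k
    have h2 := Finset.add_sum_erase Finset.univ s (Finset.mem_univ i)
    have h3 := Finset.add_sum_erase Finset.univ l (Finset.mem_univ i)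
    have h4 := hσm s hs
    lia
  refine ⟨σ, hne, hσm, fun s hs t ht i => (hupper s hs i).trans ?_, fun i => ?_⟩
  · exact Nat.add_le_add_right (hlσ t ht i) _
  · refine or_iff_not_imp_left.2 fun hi s hs => ?_
    simpa [l, C, hi] using hupper s hs i

variable {f : (I → ℝ) → I → ℝ}

theorem exists_mem_stdSimplex_le_add (hf : ContinuousOn f (stdSimplex ℝ I))
    (hmaps : Set.MapsTo f (stdSimplex ℝ I) (stdSimplex ℝ I)) {ε : ℝ} (hε : 0 < ε) :
    ∃ x ∈ stdSimplex ℝ I, ∀ i, x i ≤ f x i + ε := by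
  obtain ⟨δ, hδ, hfδ⟩ := Metric.uniformContinuousOn_iff.1
    ((isCompact_stdSimplex ℝ I).uniformContinuousOn_of_continuous hf) (ε / 2) (half_pos hε)
  set n := Fintype.card I
  have hmesh : ∀ᶠ m : ℕ in Filter.atTop, (n : ℝ) / m < min δ (ε / 2) :=
    (tendsto_const_div_atTop_nhds_zero_nat (n : ℝ)).eventually_lt_const
      (lt_min hδ (half_pos hε))
  obtain ⟨m, hm, hm0⟩ := (hmesh.and (Filter.eventually_gt_atTop 0)).exists
  obtain ⟨hmδ, hmε⟩ := lt_min_iff.1 hm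
  let point (s : I → ℕ) : I → ℝ := fun i => s i / m
  have hpoint {s : I → ℕ} (hs : ∑ i, s i = m) : point s ∈ stdSimplex ℝ I := by
    refine ⟨fun i => by positivity, ?_⟩
    rw [← Finset.sum_div, ← Nat.cast_sum, hs, div_self (by positivity)]
  obtain ⟨σ, ⟨x, hx⟩, hσm, hclose, hσ⟩ :=
    exists_finset_grid_close (P := fun s i => point s i ≤ f (point s) i) fun s hs => by
      obtain ⟨i, -, hi⟩ := Finset.exists_le_of_sum_le Finset.univ_nonempty
        ((hpoint hs).2.trans (hmaps (hpoint hs)).2.symm).le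
      exact ⟨i, hi⟩
  have point_le {s t : I → ℕ} {i : I} (h : s i ≤ t i + n) : point s i ≤ point t i + n / m := by
    simp only [point, ← add_div]
    gcongr
    exact_mod_cast h
  refine ⟨point x, hpoint (hσm x hx), fun i => ?_⟩
  rcases hσ i with ⟨s, hs, hsi⟩ | hi
  · have hdist : dist (point s) (point x) < δ := by
      refine ((dist_pi_le_iff (by positivity)).2 fun k => ?_).trans_lt hmδ
      rw [Real.dist_eq, abs_sub_le_iff, sub_le_iff_le_add', sub_le_iff_le_add']
      exact ⟨point_le (hclose s hs x hx k), point_le (hclose x hx s hs k)⟩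
    have hfdist := (dist_le_pi_dist _ _ i).trans_lt
      (hfδ _ (hpoint (hσm s hs)) _ (hpoint (hσm x hx)) hdist)
    rw [Real.dist_eq] at hfdist
    linarith [le_abs_self (f (point s) i - f (point x) i), point_le (hclose x hx s hs i)]
  · have hzero : point x i ≤ n / m := by
      simpa [point] using point_le (t := 0) (by simpa using hi x hx)
    linarith [(hmaps (hpoint (hσm x hx))).1 i]

theorem exists_isFixedPt_stdSimplex (hf : ContinuousOn f (stdSimplex ℝ I))
    (hmaps : Set.MapsTo f (stdSimplex ℝ I) (stdSimplex ℝ I)) :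
    ∃ x ∈ stdSimplex ℝ I, Function.IsFixedPt f x := by
  classical
  have hcont : ContinuousOn (fun x => Finset.univ.sup' Finset.univ_nonempty
      fun i => x i - f x i) (stdSimplex ℝ I) :=
    ContinuousOn.finset_sup'_apply _ fun i _ =>
      (continuous_apply i).continuousOn.sub (continuousOn_pi.1 hf i)
  obtain ⟨x, hx, hmin⟩ := (isCompact_stdSimplex ℝ I).exists_isMinOn
    ⟨_, single_mem_stdSimplex ℝ (Classical.arbitrary I)⟩ hcont
  have hle (i : I) : x i ≤ f x i := by
    refine sub_nonpos.1 (le_of_forall_pos_le_add fun ε hε => ?_)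
    obtain ⟨y, hy, hyi⟩ := exists_mem_stdSimplex_le_add hf hmaps hε
    calc x i - f x i ≤ Finset.univ.sup' Finset.univ_nonempty fun i => x i - f x i :=
          Finset.le_sup' (fun i => x i - f x i) (Finset.mem_univ i)
      _ ≤ Finset.univ.sup' Finset.univ_nonempty fun i => y i - f y i := hmin hy
      _ ≤ 0 + ε := Finset.sup'_le _ _ fun i _ => by linarith [hyi i]
  have hsum : ∑ i, x i = ∑ i, f x i := hx.2.trans (hmaps hx).2.symm
  exact ⟨x, hx, funext fun i =>
    ((Finset.sum_eq_sum_iff_of_le fun i _ => hle i).1 hsum i (Finset.mem_univ i)).symm⟩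

end Brouwer

section Kakutani

theorem eventually_subset_of_isClosed_graph {X Y : Type*} [TopologicalSpace X]
    [TopologicalSpace Y] {D : Set X} {K U : Set Y} {F : X → Set Y} (hK : IsCompact K)
    (hF : ∀ x ∈ D, F x ⊆ K) (hgraph : IsClosed {q : X × Y | q.1 ∈ D ∧ q.2 ∈ F q.1}) (hU : IsOpen U)
    {x : X} (hx : F x ⊆ U) : ∀ᶠ y in nhdsWithin x D, F y ⊆ U := by
  have hdisj : {x} ×ˢ (K \ U) ⊆ {q : X × Y | q.1 ∈ D ∧ q.2 ∈ F q.1}ᶜ := by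
    rintro ⟨_, z⟩ ⟨rfl, -, hzU⟩ hz
    exact hzU (hx hz.2)
  obtain ⟨V, W, hV, -, hxV, hW, hVW⟩ :=
    generalized_tube_lemma isCompact_singleton (hK.diff hU) hgraph.isOpen_compl hdisj
  filter_upwards [self_mem_nhdsWithin, mem_nhdsWithin_of_mem_nhds (hV.mem_nhds (hxV rfl))]
    with y hyD hyV z hz
  by_contra hzU
  exact hVW (Set.mk_mem_prod hyV (hW ⟨hF y hyD hz, hzU⟩)) ⟨hyD, hz⟩

variable {E : Type*} [NormedAddCommGroup E] [NormedSpace ℝ E] {K : Set E}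

theorem exists_sum_smul_eq_self {I : Type*} [Fintype I] (hne : K.Nonempty) (hconv : Convex ℝ K)
    {y : I → E} (hy : ∀ i, y i ∈ K) {w : E → I → ℝ} (hw : ContinuousOn w K)
    (hwK : Set.MapsTo w K (stdSimplex ℝ I)) : ∃ x ∈ K, ∑ i, w x i • y i = x := by
  have hmaps : Set.MapsTo (fun l : I → ℝ => ∑ i, l i • y i) (stdSimplex ℝ I) K := fun l hl =>
    hconv.sum_mem (fun i _ => hl.1 i) hl.2 fun i _ => hy i
  have : Nonempty I := by
    obtain ⟨x, hx⟩ := hne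
    by_contra! hI
    simpa using (hwK hx).2
  obtain ⟨l, hl, hfix⟩ := exists_isFixedPt_stdSimplex
    (hw.comp (by fun_prop : Continuous fun l : I → ℝ => ∑ i, l i • y i).continuousOn hmaps)
    (hwK.comp hmaps)
  exact ⟨_, hmaps hl, congrArg (fun l : I → ℝ => ∑ i, l i • y i) hfix⟩

theorem exists_continuousOn_stdSimplex_dist_lt {X : Type*} [PseudoMetricSpace X] {K : Set X}
    (hK : IsCompact K) {ε : ℝ} (hε : 0 < ε) :
    ∃ (t : Finset X) (w : X → t → ℝ), (∀ i : t, ↑i ∈ K) ∧ ContinuousOn w K ∧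
      Set.MapsTo w K (stdSimplex ℝ t) ∧ ∀ x (i : t), w x i ≠ 0 → dist ↑i x < ε := by
  obtain ⟨t, htK, htfin, hcover⟩ := hK.finite_cover_balls hε
  lift t to Finset X using htfin
  let bump (x : X) (i : t) : ℝ := max 0 (ε - dist ↑i x)
  have bump_nonneg (x : X) (i : t) : 0 ≤ bump x i := le_max_left _ _
  have sum_bump_pos (x) (hx : x ∈ K) : 0 < ∑ i, bump x i := by
    obtain ⟨i, hi, hxi⟩ := Set.mem_iUnion₂.1 (hcover hx)
    refine Finset.sum_pos' (fun i _ => bump_nonneg x i) ⟨⟨i, hi⟩, Finset.mem_univ _, ?_⟩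
    exact lt_max_of_lt_right (sub_pos.2 (Metric.mem_ball'.1 hxi))
  refine ⟨t, fun x i => bump x i / ∑ k, bump x k, fun i => htK i.2, ?_, fun x hx => ⟨?_, ?_⟩, ?_⟩
  · refine continuousOn_pi.2 fun i => ContinuousOn.div ?_ ?_ fun x hx => (sum_bump_pos x hx).ne'
    · fun_prop
    · fun_prop
  · exact fun i => div_nonneg (bump_nonneg x i) (sum_bump_pos x hx).le
  · rw [← Finset.sum_div, div_self (sum_bump_pos x hx).ne']
  · intro x i hne
    by_contra! hle
    exact hne (by simp [bump, hle])

theorem exists_mem_convexHull_iUnion_ball (hK : IsCompact K) (hconv : Convex ℝ K)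
    (hne : K.Nonempty) {F : E → Set E} (hF : ∀ x ∈ K, F x ⊆ K) (hFne : ∀ x ∈ K, (F x).Nonempty)
    {ε : ℝ} (hε : 0 < ε) : ∃ x ∈ K, x ∈ convexHull ℝ (⋃ y ∈ K ∩ Metric.ball x ε, F y) := by
  obtain ⟨t, w, htK, hw, hwK, hwε⟩ := exists_continuousOn_stdSimplex_dist_lt hK hε
  choose y hy using fun i : t => hFne i (htK i)
  obtain ⟨x, hx, hfix⟩ := exists_sum_smul_eq_self hne hconv
    (fun i : t => hF i (htK i) (hy i)) hw hwK
  refine ⟨x, hx, ?_⟩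
  have hsupp : ∑ i with w x i ≠ 0, w x i • y i = x := by
    rw [Finset.sum_filter_of_ne fun i _ h => left_ne_zero_of_smul h, hfix]
  rw [← hsupp]
  refine (convex_convexHull ℝ _).sum_mem (fun i _ => (hwK hx).1 i) ?_ fun i hi => ?_
  · rw [Finset.sum_filter_of_ne fun _ _ h => h, (hwK hx).2]
  · rw [hsupp]
    have hix : ↑i ∈ K ∩ Metric.ball x ε := ⟨htK i, hwε x i (Finset.mem_filter.1 hi).2⟩
    exact subset_convexHull ℝ _ (Set.mem_biUnion hix (hy i))

theorem exists_mem_self_of_isClosed_graph (hK : IsCompact K) (hconv : Convex ℝ K)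
    (hne : K.Nonempty) {F : E → Set E} (hF : ∀ x ∈ K, F x ⊆ K) (hFne : ∀ x ∈ K, (F x).Nonempty)
    (hFconv : ∀ x ∈ K, Convex ℝ (F x)) (hgraph : IsClosed {q : E × E | q.1 ∈ K ∧ q.2 ∈ F q.1}) :
    ∃ x ∈ K, x ∈ F x := by
  have happrox (n : ℕ) := exists_mem_convexHull_iUnion_ball hK hconv hne hF hFne
    (Nat.one_div_pos_of_nat (α := ℝ) (n := n))
  choose u huK hu using happrox
  obtain ⟨x, hx, θ, hθ, hlim⟩ := hK.tendsto_subseq huK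
  have hclosed : IsClosed (F x) := by
    simpa [hx] using hgraph.preimage (Continuous.prodMk_right x)
  refine ⟨x, hx, ?_⟩
  rw [← hclosed.closure_eq, Metric.closure_eq_iInter_cthickening]
  refine Set.mem_iInter₂.2 fun η hη => ?_
  obtain ⟨δ, hδ, hnear⟩ := Metric.mem_nhdsWithin_iff.1 <| eventually_subset_of_isClosed_graph hK hF
    hgraph Metric.isOpen_thickening (Metric.self_subset_thickening hη (F x))
  refine Metric.isClosed_cthickening.mem_of_tendsto hlim ?_
  filter_upwards [hlim.eventually (Metric.ball_mem_nhds x (half_pos hδ)),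
    (tendsto_one_div_add_atTop_nhds_zero_nat.comp hθ.tendsto_atTop).eventually_lt_const
      (half_pos hδ)] with n hn hθn
  refine Metric.thickening_subset_cthickening _ _
    (convexHull_min (Set.iUnion₂_subset fun y hy => ?_) ((hFconv x hx).thickening η) (hu (θ n)))
  refine hnear ⟨Metric.mem_ball.2 ?_, hy.1⟩
  calc dist y x ≤ dist y (u (θ n)) + dist (u (θ n)) x := dist_triangle _ _ _
    _ < δ / 2 + δ / 2 := add_lt_add ((Metric.mem_ball.1 hy.2).trans hθn) hn
    _ = δ := add_halves δ

end Kakutani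

section Maximizers

theorem convex_setOf_isMaxOn {𝕜 E β : Type*} [Semiring 𝕜] [PartialOrder 𝕜] [AddCommMonoid E]
    [SMul 𝕜 E] [Preorder β] {s : Set E} {f : E → β} (hf : QuasiconcaveOn 𝕜 s f) :
    Convex 𝕜 {x ∈ s | IsMaxOn f s x} := by
  intro x hx y hy a b ha hb hab
  have hxy : ∀ w ∈ s, a • x + b • y ∈ {v ∈ s | f w ≤ f v} := fun w hw =>
    hf (f w) ⟨hx.1, hx.2 hw⟩ ⟨hy.1, hy.2 hw⟩ ha hb hab
  exact ⟨(hxy x hx.1).1, fun w hw => (hxy w hw).2⟩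

theorem isClosed_setOf_isMaxOn {X Y β : Type*} [TopologicalSpace X] [TopologicalSpace β]
    [Preorder β] [OrderClosedTopology β] {s : Set Y} {f : X → Y → β} {g : X → Y}
    (hf : ∀ y ∈ s, Continuous fun x => f x y) (hg : Continuous fun x => f x (g x)) :
    IsClosed {x | IsMaxOn (f x) s (g x)} := by
  simp only [isMaxOn_iff, Set.ofPred_forall]
  exact isClosed_biInter fun y hy => isClosed_le (hf y hy) hg

theorem isClosed_setOf_isMinOn {X Y β : Type*} [TopologicalSpace X] [TopologicalSpace β]
    [Preorder β] [OrderClosedTopology β] {s : Set Y} {f : X → Y → β} {g : X → Y}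
    (hf : ∀ y ∈ s, Continuous fun x => f x y) (hg : Continuous fun x => f x (g x)) :
    IsClosed {x | IsMinOn (f x) s (g x)} :=
  isClosed_setOf_isMaxOn (β := βᵒᵈ) hf hg

theorem le_dotProduct_of_isMaxOn_stdSimplex {ι : Type*} [Fintype ι] {p e : ι → ℝ}
    (h : IsMaxOn (· ⬝ᵥ e) (stdSimplex ℝ ι) p) (a : ι) : e a ≤ p ⬝ᵥ e := by
  classical
  simpa using h (single_mem_stdSimplex ℝ a)

theorem concaveOn_sum {ι E : Type*} [AddCommMonoid E] [Module ℝ E] {s : Set E} (hs : Convex ℝ s)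
    (t : Finset ι) {f : ι → E → ℝ} (hf : ∀ i ∈ t, ConcaveOn ℝ s (f i)) :
    ConcaveOn ℝ s fun x => ∑ i ∈ t, f i x := by
  classical
  induction t using Finset.induction_on with
  | empty => simpa using concaveOn_const (0 : ℝ) hs
  | insert i t hi ih =>
    simp only [Finset.sum_insert hi]
    exact (hf i (by simp)).add (ih fun j hj => hf j (by simp [hj]))

theorem eq_zero_of_dotProduct_nonpos {ι R : Type*} [Fintype ι] [Semiring R] [PartialOrder R]
    [IsOrderedRing R] [NoZeroDivisors R] {p x : ι → R} (hp : ∀ a, 0 < p a) (hx : 0 ≤ x)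
    (h : p ⬝ᵥ x ≤ 0) : x = 0 := by
  have hnonneg : ∀ a ∈ Finset.univ, 0 ≤ p a * x a := fun a _ => mul_nonneg (hp a).le (hx a)
  have hsum := (Finset.sum_eq_zero_iff_of_nonneg hnonneg).1 (h.antisymm (Finset.sum_nonneg hnonneg))
  exact funext fun a => (mul_eq_zero.1 (hsum a (Finset.mem_univ a))).resolve_left (hp a).ne'

end Maximizers

section Rationing

theorem min_max_zero_sub_add_min {R : Type*} [AddCommGroup R] [LinearOrder R]
    [IsOrderedAddMonoid R] {a : R} (ha : 0 ≤ a) (q s : R) :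
    min a (max 0 (q - s)) + min q s = min q (a + s) := by
  rcases le_total q s with h | h
  · rw [max_eq_left (sub_nonpos.2 h), min_eq_right ha, zero_add, min_eq_left h,
      min_eq_left (h.trans (le_add_of_nonneg_left ha))]
  · rw [max_eq_right (sub_nonneg.2 h), min_eq_right h, ← min_add_add_right,
      sub_add_cancel, min_comm]

theorem sum_min_max_sub_sum_lt {K R : Type*} [LinearOrder K] [AddCommGroup R] [LinearOrder R]
    [IsOrderedAddMonoid R] (s : Finset K) {a : K → R} (ha : ∀ k, 0 ≤ a k) {q : R} (hq : 0 ≤ q) :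
    ∑ k ∈ s, min (a k) (max 0 (q - ∑ k' ∈ s, if k' < k then a k' else 0)) =
      min q (∑ k ∈ s, a k) := by
  induction s using Finset.induction_on_max with
  | empty => simp [hq]
  | insert m s hm ih =>
    have hms : m ∉ s := fun h => lt_irrefl m (hm m h)
    have hlower : ∀ k ∈ s, (∑ k' ∈ insert m s, if k' < k then a k' else 0) =
        ∑ k' ∈ s, if k' < k then a k' else 0 := fun k hk => by
      rw [Finset.sum_insert hms, if_neg (hm k hk).not_gt, zero_add]
    have htop : (∑ k' ∈ insert m s, if k' < m then a k' else 0) = ∑ k' ∈ s, a k' := by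
      rw [Finset.sum_insert hms, if_neg (lt_irrefl m), zero_add,
        Finset.sum_congr rfl fun k hk => if_pos (hm k hk)]
    have hrest : ∑ k ∈ s, min (a k) (max 0 (q - ∑ k' ∈ insert m s, if k' < k then a k' else 0)) =
        min q (∑ k ∈ s, a k) :=
      (Finset.sum_congr rfl fun k hk => by rw [hlower k hk]).trans ih
    rw [Finset.sum_insert hms, htop, hrest, min_max_zero_sub_add_min (ha m),
      Finset.sum_insert hms]

end Rationing

namespace MixedMarket

section Utility

variable {A C J : Type*} {S : J → Type*}

theorem exists_lt_utility_update [DecidableEq (C ⊕ J)] (M : MixedMarket A C J S) (i : A)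
    {z : C ⊕ J → ℝ} (hz : 0 ≤ z) (a : C ⊕ J) :
    ∃ t, z a < t ∧ M.utility i z < M.utility i (Function.update z a t) := by
  obtain ⟨z', hoff, hlt, hU⟩ := M.utility_nonsatiated i z hz a
  exact ⟨z' a, hlt, by rwa [← Function.eq_update_iff.2 ⟨rfl, hoff⟩]⟩

-- Otherwise a still larger amount of the good would be better than `z`, against quasi-concavity.
theorem utility_le_utility_update [DecidableEq (C ⊕ J)] (M : MixedMarket A C J S) (i : A)
    {z : C ⊕ J → ℝ} (hz : 0 ≤ z) {a : C ⊕ J} {t : ℝ} (ht : z a ≤ t) :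
    M.utility i z ≤ M.utility i (Function.update z a t) := by
  by_contra! hlt
  have hz₁ : 0 ≤ Function.update z a t := hz.trans (le_update_self_iff.2 ht)
  obtain ⟨t', htt', hU⟩ := M.exists_lt_utility_update i hz₁ a
  simp only [Function.update_self, Function.update_idem] at htt' hU
  have hz₂ : 0 ≤ Function.update z a t' := hz.trans (le_update_self_iff.2 (ht.trans htt'.le))
  have hmem : Function.update z a t ∈ segment ℝ z (Function.update z a t') := by
    have := Pi.image_update_segment (𝕜 := ℝ) a (z a) t' z
    rw [Function.update_eq_self, segment_eq_Icc (ht.trans htt'.le)] at this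
    exact this ▸ Set.mem_image_of_mem _ ⟨ht, htt'.le⟩
  have hconv := M.utility_quasiconcave i
    (min (M.utility i z) (M.utility i (Function.update z a t')))
  exact (hconv.segment_subset ⟨hz, min_le_left _ _⟩ ⟨hz₂, min_le_right _ _⟩ hmem).2.not_gt
    (lt_min hlt hU)

theorem utility_mono [Finite C] [Finite J] (M : MixedMarket A C J S) (i : A)
    {z z' : C ⊕ J → ℝ} (hz : 0 ≤ z) (h : z ≤ z') : M.utility i z ≤ M.utility i z' := by
  classical
  have := Fintype.ofFinite (C ⊕ J)
  have key : ∀ s : Finset (C ⊕ J), M.utility i z ≤ M.utility i (s.piecewise z' z) := by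
    intro s
    induction s using Finset.induction_on with
    | empty => simp
    | insert a s ha ih =>
      rw [Finset.piecewise_insert]
      refine ih.trans (M.utility_le_utility_update i ?_ ?_)
      · exact hz.trans (Finset.le_piecewise_of_le_of_le s h le_rfl)
      · simpa [ha] using h a
  simpa using key Finset.univ

theorem isClosed_setOf_le_utility {X : Type*} [TopologicalSpace X] (M : MixedMarket A C J S)
    (i : A) {v : X → ℝ} {z : X → C ⊕ J → ℝ} (hv : Continuous v) (hz : Continuous z) :
    IsClosed {x | 0 ≤ z x ∧ v x ≤ M.utility i (z x)} :=
  (isClosed_le continuous_const hz).isClosed_le hv.continuousOn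
    ((M.utility_continuous i).comp hz.continuousOn fun _ h => h)

theorem exists_lt_utility_dotProduct_lt [Fintype C] [Fintype J] (M : MixedMarket A C J S) (i : A)
    {p z : C ⊕ J → ℝ} (hz : 0 ≤ z) {v : ℝ} (hv : v < M.utility i z) (hp : 0 < p ⬝ᵥ z) :
    ∃ z', 0 ≤ z' ∧ v < M.utility i z' ∧ p ⬝ᵥ z' < p ⬝ᵥ z := by
  have hc : ContinuousOn (fun t : ℝ => M.utility i (t • z)) (Set.Ici 0) :=
    (M.utility_continuous i).comp (by fun_prop) fun t ht => smul_nonneg ht hz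
  have hev : ∀ᶠ t in 𝓝[<] (1 : ℝ), v < M.utility i (t • z) :=
    nhdsWithin_le_nhds <| (hc.continuousAt (Ici_mem_nhds one_pos)).eventually_const_lt <| by
      simpa only [one_smul] using hv
  obtain ⟨t, ht, h0, h1⟩ := (hev.and (Ioo_mem_nhdsLT zero_lt_one)).exists
  exact ⟨t • z, smul_nonneg h0.le hz, ht, by
    simpa only [dotProduct_smul, smul_eq_mul] using mul_lt_of_lt_one_left hp h1⟩

theorem exists_le_forall_utility_lt [Finite A] [Nonempty A] [Finite C] [Finite J]
    [Nonempty (C ⊕ J)] (M : MixedMarket A C J S) {b : C ⊕ J → ℝ} (hb : 0 ≤ b) :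
    ∃ r, b ≤ r ∧ ∀ i, M.utility i b < M.utility i r := by
  classical
  have := Fintype.ofFinite A
  let a := Classical.arbitrary (C ⊕ J)
  choose t hbt hU using fun i => M.exists_lt_utility_update i hb a
  have hle : ∀ i, b ≤ Function.update b a (t i) := fun i => le_update_self_iff.2 (hbt i).le
  let r := Finset.univ.sup' Finset.univ_nonempty fun i => Function.update b a (t i)
  have hr : ∀ i, Function.update b a (t i) ≤ r := fun i =>
    Finset.le_sup' (fun i => Function.update b a (t i)) (Finset.mem_univ i)
  exact ⟨r, (hle (Classical.arbitrary A)).trans (hr _), fun i =>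
    (hU i).trans_le (M.utility_mono i (hb.trans (hle i)) (hr i))⟩

end Utility

section Supply

variable {A C J : Type*} {S : J → Type*}

theorem available_nonneg {y : A → C ⊕ J → ℝ} (hy : 0 ≤ y) (j : J) (k : S j ⊕ A) :
    0 ≤ available y j k := by
  rcases k with _ | i
  · exact zero_le_one
  · exact hy i (Sum.inr j)

theorem continuous_available (j : J) (k : S j ⊕ A) :
    Continuous fun y : A → C ⊕ J → ℝ => available y j k := by
  rcases k with _ | i
  · exact continuous_const
  · exact (continuous_apply _).comp (continuous_apply i)

variable [Fintype A]

/-- The largest demand of an agent for songs of a category counts as the demand for the category,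
since all agents can buy the same song; it is compared with `supply`. -/
def demand [Nonempty A] (z : A → C ⊕ J → ℝ) : C ⊕ J → ℝ
  | Sum.inl c => ∑ i, z i (Sum.inl c)
  | Sum.inr j => Finset.univ.sup' Finset.univ_nonempty fun i => z i (Sum.inr j)

theorem le_demand [Nonempty A] {z : A → C ⊕ J → ℝ} (hz : 0 ≤ z) (i : A) : z i ≤ demand z := by
  rintro (c | j)
  · exact Finset.single_le_sum (f := fun i => z i (Sum.inl c)) (fun i _ => hz i _)
      (Finset.mem_univ i)
  · exact Finset.le_sup' (fun i => z i (Sum.inr j)) (Finset.mem_univ i)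

theorem continuous_demand [Nonempty A] :
    Continuous (demand : (A → C ⊕ J → ℝ) → C ⊕ J → ℝ) := by
  refine continuous_pi fun a => ?_
  rcases a with c | j
  · simp only [demand]
    fun_prop
  · simp only [demand]
    exact Continuous.finset_sup'_apply Finset.univ_nonempty fun i _ => by fun_prop

theorem demand_sub_le_sum_sub_min [Nonempty A] (z : A → C ⊕ J → ℝ) (j : J) (s : ℝ) :
    demand z (Sum.inr j) - s ≤ ∑ i, (z i (Sum.inr j) - min (z i (Sum.inr j)) s) := by
  refine sub_le_iff_le_add.2 (Finset.sup'_le Finset.univ_nonempty _ fun i _ => ?_)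
  have hi := Finset.single_le_sum (f := fun i => z i (Sum.inr j) - min (z i (Sum.inr j)) s)
    (fun i _ => sub_nonneg.2 (min_le_left _ _)) (Finset.mem_univ i)
  exact sub_le_iff_le_add.1 ((sub_le_sub_left (min_le_right _ _) _).trans hi)

variable [∀ j, Fintype (S j)]

variable (S) in
/-- What there is of each good under the production `y`; the supply of a digital category is the
number `Y_j` of its songs, old and new. -/
def supply (y : A → C ⊕ J → ℝ) : C ⊕ J → ℝ
  | Sum.inl c => ∑ i, y i (Sum.inl c)
  | Sum.inr j => ∑ k : S j ⊕ A, available y j k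

variable (S) in
theorem continuous_supply : Continuous (supply S : (A → C ⊕ J → ℝ) → C ⊕ J → ℝ) := by
  refine continuous_pi fun a => ?_
  rcases a with c | j
  · simp only [supply]
    fun_prop
  · exact continuous_finsetSum _ fun k _ => continuous_available j k

theorem exists_supply_le [Finite C] [Finite J] (M : MixedMarket A C J S) :
    ∃ b : C ⊕ J → ℝ, 0 ≤ b ∧ ∀ y : A → C ⊕ J → ℝ, (∀ i, y i ∈ M.production i) →
      supply S y ≤ b := by
  have := Fintype.ofFinite (C ⊕ J)
  have hK : IsCompact (supply S '' Set.univ.pi M.production) :=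
    (isCompact_univ_pi M.production_compact).image (continuous_supply S)
  obtain ⟨b, hb⟩ := hK.isBounded.bddAbove
  exact ⟨b ⊔ 0, le_sup_right, fun y hy =>
    (hb (Set.mem_image_of_mem _ fun i _ => hy i)).trans le_sup_left⟩

theorem continuous_availableAbove (M : MixedMarket A C J S) (i : A) (j : J) (k : S j ⊕ A) :
    Continuous fun y : A → C ⊕ J → ℝ => M.availableAbove y i j k := by
  unfold availableAbove
  refine continuous_finsetSum _ fun k' _ => ?_
  split_ifs
  · exact continuous_available j k'
  · exact continuous_const

theorem detailed_nonneg (M : MixedMarket A C J S) {y : A → C ⊕ J → ℝ} (hy : 0 ≤ y) (i : A) (j : J)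
    (q : ℝ) (k : S j ⊕ A) : 0 ≤ M.detailed y i j q k :=
  le_min (available_nonneg hy j k) (le_max_left _ _)

theorem sum_detailed (M : MixedMarket A C J S) {y : A → C ⊕ J → ℝ} (hy : 0 ≤ y) (i : A) (j : J)
    {q : ℝ} (hq : 0 ≤ q) :
    ∑ k : S j ⊕ A, M.detailed y i j q k = min q (supply S y (Sum.inr j)) := by
  classical
  have := M.prefers_total i j
  let _ : LinearOrder (S j ⊕ A) := linearOrderOfSTO (M.prefers i j)
  rw [supply, ← sum_min_max_sub_sum_lt Finset.univ (available_nonneg hy j) hq]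
  refine Finset.sum_congr rfl fun k _ => ?_
  unfold detailed availableAbove
  congr! 5

theorem availableAbove_add_available_le (M : MixedMarket A C J S) {y : A → C ⊕ J → ℝ}
    (hy : 0 ≤ y) (i : A) (j : J) (k : S j ⊕ A) :
    M.availableAbove y i j k + available y j k ≤ supply S y (Sum.inr j) := by
  classical
  have := M.prefers_total i j
  have hk : k ∉ Finset.univ.filter (M.prefers i j · k) := by simp [irrefl_of (M.prefers i j) k]
  rw [availableAbove, ← Finset.sum_filter, add_comm, ← Finset.sum_insert hk]
  exact Finset.sum_le_univ_sum_of_nonneg fun k' => available_nonneg hy j k'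

theorem detailed_of_supply_le (M : MixedMarket A C J S) {y : A → C ⊕ J → ℝ} (hy : 0 ≤ y) (i : A)
    {j : J} {q : ℝ} (hq : supply S y (Sum.inr j) ≤ q) (k : S j ⊕ A) :
    M.detailed y i j q k = available y j k :=
  min_eq_left (le_max_of_le_right
    (le_sub_iff_add_le'.2 ((M.availableAbove_add_available_le hy i j k).trans hq)))

end Supply

section Sales

variable {A C J : Type*} {S : J → Type*} [Fintype A] [Fintype C] [Fintype J]
  [∀ j, Fintype (S j)]

/-- The part of the earnings of agent `i` that comes from her production `y'`, when the others
produce `y` and the agents want the songs in the coarse allocation `z`. -/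
noncomputable def profit (M : MixedMarket A C J S) (p : C ⊕ J → ℝ) (z y : A → C ⊕ J → ℝ) (i : A)
    (y' : C ⊕ J → ℝ) : ℝ :=
  ∑ c : C, p (Sum.inl c) * y' (Sum.inl c) +
  ∑ j : J, p (Sum.inr j) * ∑ b : A, min (y' (Sum.inr j))
    (max 0 (z b (Sum.inr j) - M.availableAbove y b j (Sum.inr i)))

theorem sum_mul_le_profit (M : MixedMarket A C J S) {p : C ⊕ J → ℝ} (hp : 0 ≤ p)
    (z y : A → C ⊕ J → ℝ) (i : A) {y' : C ⊕ J → ℝ} (hy' : 0 ≤ y') :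
    ∑ c : C, p (Sum.inl c) * y' (Sum.inl c) ≤ M.profit p z y i y' :=
  le_add_of_nonneg_right <| Finset.sum_nonneg fun _ _ => mul_nonneg (hp _) <|
    Finset.sum_nonneg fun _ _ => le_min (hy' _) (le_max_left _ _)

theorem mul_le_profit (M : MixedMarket A C J S) {p : C ⊕ J → ℝ} (hp : 0 ≤ p)
    (z y : A → C ⊕ J → ℝ) (i : A) {y' : C ⊕ J → ℝ} (hy' : 0 ≤ y') (c : C) :
    p (Sum.inl c) * y' (Sum.inl c) ≤ M.profit p z y i y' :=
  (Finset.single_le_sum (f := fun c => p (Sum.inl c) * y' (Sum.inl c))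
    (fun _ _ => mul_nonneg (hp _) (hy' _)) (Finset.mem_univ c)).trans
      (M.sum_mul_le_profit hp z y i hy')

theorem profit_nonneg (M : MixedMarket A C J S) {p : C ⊕ J → ℝ} (hp : 0 ≤ p)
    (z y : A → C ⊕ J → ℝ) (i : A) {y' : C ⊕ J → ℝ} (hy' : 0 ≤ y') : 0 ≤ M.profit p z y i y' :=
  (Finset.sum_nonneg fun c _ => mul_nonneg (hp (Sum.inl c)) (hy' (Sum.inl c))).trans
    (M.sum_mul_le_profit hp z y i hy')

theorem concaveOn_profit (M : MixedMarket A C J S) {p : C ⊕ J → ℝ} (hp : 0 ≤ p)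
    (z y : A → C ⊕ J → ℝ) (i : A) : ConcaveOn ℝ Set.univ (M.profit p z y i) := by
  have hcoord : ∀ a : C ⊕ J, ConcaveOn ℝ Set.univ fun y' : C ⊕ J → ℝ => y' a := fun a =>
    (LinearMap.proj (R := ℝ) (φ := fun _ : C ⊕ J => ℝ) a).concaveOn convex_univ
  exact (concaveOn_sum convex_univ _ fun c _ => (hcoord (Sum.inl c)).smul (hp _)).add <|
    concaveOn_sum convex_univ _ fun j _ => (concaveOn_sum convex_univ _ fun b _ =>
      (hcoord (Sum.inr j)).inf (concaveOn_const _ convex_univ)).smul (hp _)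

theorem continuous_profit {X : Type*} [TopologicalSpace X] (M : MixedMarket A C J S) (i : A)
    {p y' : X → C ⊕ J → ℝ} {z y : X → A → C ⊕ J → ℝ} (hp : Continuous p) (hz : Continuous z)
    (hy : Continuous y) (hy' : Continuous y') :
    Continuous fun x => M.profit (p x) (z x) (y x) i (y' x) := by
  have h : ∀ b j, Continuous fun x => M.availableAbove (y x) b j (Sum.inr i) :=
    fun b j => (M.continuous_availableAbove b j (Sum.inr i)).comp hy
  unfold profit
  fun_prop

theorem isClosed_setOf_isMaxOn_profit {X : Type*} [TopologicalSpace X] (M : MixedMarket A C J S)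
    (i : A) (P : Set (C ⊕ J → ℝ)) {p y' : X → C ⊕ J → ℝ} {z y : X → A → C ⊕ J → ℝ}
    (hp : Continuous p) (hz : Continuous z) (hy : Continuous y) (hy' : Continuous y') :
    IsClosed {x | IsMaxOn (M.profit (p x) (z x) (y x) i) P (y' x)} :=
  isClosed_setOf_isMaxOn (fun _ _ => M.continuous_profit i hp hz hy continuous_const)
    (M.continuous_profit i hp hz hy hy')

variable (S) in
/-- What the agents pay under the coarse allocation `z` if all conventional goods of the production
`y` are sold, and of the songs each agent gets those that she wants, as far as there are any. -/
noncomputable def totalSales (p : C ⊕ J → ℝ) (z y : A → C ⊕ J → ℝ) : ℝ :=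
  ∑ c : C, p (Sum.inl c) * supply S y (Sum.inl c) +
  ∑ j : J, p (Sum.inr j) * ∑ b : A, min (z b (Sum.inr j)) (supply S y (Sum.inr j))

theorem sum_profit_add_initial_sales (M : MixedMarket A C J S) (p : C ⊕ J → ℝ)
    {z y : A → C ⊕ J → ℝ} (hz : 0 ≤ z) (hy : 0 ≤ y) :
    ∑ i, M.profit p z y i (y i) + ∑ j : J, p (Sum.inr j) * ∑ b, ∑ s : S j,
      M.detailed y b j (z b (Sum.inr j)) (Sum.inl s) = totalSales S p z y := by
  have hprofit : ∑ i, M.profit p z y i (y i) = ∑ c : C, p (Sum.inl c) * supply S y (Sum.inl c) +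
      ∑ j : J, p (Sum.inr j) * ∑ b, ∑ i : A, M.detailed y b j (z b (Sum.inr j)) (Sum.inr i) := by
    simp only [profit, Finset.sum_add_distrib, supply, Finset.mul_sum]
    congr 1
    · exact Finset.sum_comm
    · rw [Finset.sum_comm]
      exact Finset.sum_congr rfl fun j _ => Finset.sum_comm
  rw [hprofit, totalSales, add_assoc, ← Finset.sum_add_distrib]
  congr 1
  refine Finset.sum_congr rfl fun j _ => ?_
  rw [← mul_add, ← Finset.sum_add_distrib]
  congr 1
  refine Finset.sum_congr rfl fun b _ => ?_
  rw [← M.sum_detailed hy b j (hz b _), Fintype.sum_sum_type, add_comm]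

theorem sum_profit_le_totalSales (M : MixedMarket A C J S) {p : C ⊕ J → ℝ} (hp : 0 ≤ p)
    {z y : A → C ⊕ J → ℝ} (hz : 0 ≤ z) (hy : 0 ≤ y) :
    ∑ i, M.profit p z y i (y i) ≤ totalSales S p z y := by
  rw [← M.sum_profit_add_initial_sales p hz hy]
  exact le_add_of_nonneg_right <| Finset.sum_nonneg fun j _ => mul_nonneg (hp _) <|
    Finset.sum_nonneg fun b _ => Finset.sum_nonneg fun s _ => M.detailed_nonneg hy _ _ _ _

open Classical in
theorem earnings_eq_profit_add (M : MixedMarket A C J S) (p : C ⊕ J → ℝ) {z y : A → C ⊕ J → ℝ}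
    (hz : 0 ≤ z) (hy : 0 ≤ y) (hle : ∀ b (j : J), z b (Sum.inr j) ≤ supply S y (Sum.inr j))
    (i : A) (y' : C ⊕ J → ℝ) :
    M.earnings p (fun b j k => M.detailed y b j (z b (Sum.inr j)) k) y i y' =
      M.profit p z y i y' + ∑ j : J, p (Sum.inr j) * ∑ b, ∑ s : S j,
        if M.owner j s = i then M.detailed y b j (z b (Sum.inr j)) (Sum.inl s) else 0 := by
  simp only [earnings, profit, M.sum_detailed hy _ _ (hz _ _), min_eq_left (hle _ _),
    Finset.sum_add_distrib, mul_add]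
  ring

theorem sum_earnings (M : MixedMarket A C J S) (p : C ⊕ J → ℝ) {z y : A → C ⊕ J → ℝ}
    (hz : 0 ≤ z) (hy : 0 ≤ y) (hle : ∀ b (j : J), z b (Sum.inr j) ≤ supply S y (Sum.inr j)) :
    ∑ i, M.earnings p (fun b j k => M.detailed y b j (z b (Sum.inr j)) k) y i (y i) =
      totalSales S p z y := by
  classical
  have howner : ∀ j b, ∑ i, ∑ s : S j,
      (if M.owner j s = i then M.detailed y b j (z b (Sum.inr j)) (Sum.inl s) else 0) =
        ∑ s : S j, M.detailed y b j (z b (Sum.inr j)) (Sum.inl s) := fun j b => by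
    rw [Finset.sum_comm]
    exact Finset.sum_congr rfl fun s _ => Fintype.sum_ite_eq _ _
  rw [← M.sum_profit_add_initial_sales p hz hy]
  simp only [M.earnings_eq_profit_add p hz hy hle, Finset.sum_add_distrib, ← howner]
  congr 1
  rw [Finset.sum_comm]
  refine Finset.sum_congr rfl fun j _ => ?_
  rw [← Finset.mul_sum, Finset.sum_comm]

theorem sum_dotProduct_conventional_le (M : MixedMarket A C J S) {p : C ⊕ J → ℝ} (hp : 0 ≤ p)
    {z y y₀ z₀ : A → C ⊕ J → ℝ} (hz : 0 ≤ z) (hy : 0 ≤ y)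
    (hopt : ∀ i, IsMaxOn (M.profit p z y i) (M.production i) (y i))
    (hy₀ : ∀ i, y₀ i ∈ M.production i) (hz₀J : ∀ i (j : J), z₀ i (Sum.inr j) = 0)
    (hclear : ∀ c : C, ∑ i, z₀ i (Sum.inl c) = ∑ i, y₀ i (Sum.inl c)) :
    ∑ i, p ⬝ᵥ z₀ i ≤ totalSales S p z y := by
  calc ∑ i, p ⬝ᵥ z₀ i = ∑ c : C, p (Sum.inl c) * ∑ i, z₀ i (Sum.inl c) := by
        simp only [dotProduct, Fintype.sum_sum_type, hz₀J, mul_zero, Finset.sum_const_zero,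
          add_zero, Finset.mul_sum]
        exact Finset.sum_comm
    _ = ∑ i, ∑ c : C, p (Sum.inl c) * y₀ i (Sum.inl c) := by
        simp only [hclear, Finset.mul_sum]
        exact Finset.sum_comm
    _ ≤ ∑ i, M.profit p z y i (y i) := Finset.sum_le_sum fun i _ =>
        (M.sum_mul_le_profit hp z y i (M.production_nonneg i _ (hy₀ i))).trans (hopt i (hy₀ i))
    _ ≤ totalSales S p z y := M.sum_profit_le_totalSales hp hz hy

theorem totalSales_pos (M : MixedMarket A C J S) {p : C ⊕ J → ℝ} (hp : 0 ≤ p)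
    {z y : A → C ⊕ J → ℝ} (hz : 0 ≤ z) (hy : 0 ≤ y)
    (hopt : ∀ i, IsMaxOn (M.profit p z y i) (M.production i) (y i)) {c : C}
    (hc : 0 < p (Sum.inl c)) : 0 < totalSales S p z y := by
  obtain ⟨i, y', hy', hpos⟩ := M.producible c
  calc 0 < p (Sum.inl c) * y' (Sum.inl c) := mul_pos hc hpos
    _ ≤ M.profit p z y i y' := M.mul_le_profit hp z y i (M.production_nonneg i y' hy') c
    _ ≤ M.profit p z y i (y i) := hopt i hy'
    _ ≤ ∑ i, M.profit p z y i (y i) := Finset.single_le_sum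
        (f := fun i => M.profit p z y i (y i)) (fun i _ => M.profit_nonneg hp z y i (hy i))
        (Finset.mem_univ i)
    _ ≤ totalSales S p z y := M.sum_profit_le_totalSales hp hz hy

theorem dotProduct_demand_sub_supply_le [Nonempty A] {p : C ⊕ J → ℝ} (hp : 0 ≤ p)
    (z y : A → C ⊕ J → ℝ) :
    p ⬝ᵥ (demand z - supply S y) ≤ ∑ i, p ⬝ᵥ z i - totalSales S p z y := by
  have hdigital : ∑ j, p (Sum.inr j) * (demand z (Sum.inr j) - supply S y (Sum.inr j)) ≤
      ∑ j, p (Sum.inr j) *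
        ∑ i, (z i (Sum.inr j) - min (z i (Sum.inr j)) (supply S y (Sum.inr j))) :=
    Finset.sum_le_sum fun j _ =>
      mul_le_mul_of_nonneg_left (demand_sub_le_sum_sub_min z j _) (hp _)
  simp only [Finset.sum_sub_distrib, mul_sub] at hdigital
  have hvalue : ∑ i, p ⬝ᵥ z i = ∑ c : C, p (Sum.inl c) * demand z (Sum.inl c) +
      ∑ j : J, p (Sum.inr j) * ∑ i, z i (Sum.inr j) := by
    rw [← dotProduct_sum, dotProduct, Fintype.sum_sum_type]
    simp only [Finset.sum_apply, demand]
  rw [hvalue]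
  simp only [totalSales, dotProduct, Fintype.sum_sum_type, Pi.sub_apply, mul_sub,
    Finset.sum_sub_distrib]
  linarith

end Sales

section CompensatedDemand

variable {A C J : Type*} {S : J → Type*} [Fintype C] [Fintype J]

/-- Compensated demand at prices `p` and utility `v`: the bundles with utility at least `v` that
cost no more than any bundle of `B` with utility above `v`. (A bundle with utility exactly `v` may
be cheaper.) -/
def compensatedDemand (M : MixedMarket A C J S) (B : Set (C ⊕ J → ℝ)) (i : A) (p : C ⊕ J → ℝ)
    (v : ℝ) : Set (C ⊕ J → ℝ) :=
  {z | (0 ≤ z ∧ v ≤ M.utility i z) ∧ ∀ z' ∈ B, v < M.utility i z' → p ⬝ᵥ z ≤ p ⬝ᵥ z'}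

theorem compensatedDemand_anti (M : MixedMarket A C J S) {B B' : Set (C ⊕ J → ℝ)} (h : B ⊆ B')
    (i : A) (p : C ⊕ J → ℝ) (v : ℝ) :
    M.compensatedDemand B' i p v ⊆ M.compensatedDemand B i p v :=
  fun _ hz => ⟨hz.1, fun z' hz' => hz.2 z' (h hz')⟩

theorem convex_compensatedDemand (M : MixedMarket A C J S) (B : Set (C ⊕ J → ℝ)) (i : A)
    (p : C ⊕ J → ℝ) (v : ℝ) : Convex ℝ (M.compensatedDemand B i p v) := by
  have hp : IsLinearMap ℝ (p ⬝ᵥ · : (C ⊕ J → ℝ) → ℝ) :=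
    ⟨dotProduct_add p, fun t z => dotProduct_smul t p z⟩
  exact fun z₁ h₁ z₂ h₂ s t hs ht hst => ⟨M.utility_quasiconcave i v h₁.1 h₂.1 hs ht hst,
    fun z' hz' hv => convex_halfSpace_le hp _ (h₁.2 z' hz' hv) (h₂.2 z' hz' hv) hs ht hst⟩

theorem isClosed_setOf_mem_compensatedDemand {X : Type*} [TopologicalSpace X]
    (M : MixedMarket A C J S) (B : Set (C ⊕ J → ℝ)) (i : A) {v : X → ℝ} {p z : X → C ⊕ J → ℝ}
    (hv : Continuous v) (hp : Continuous p) (hz : Continuous z) :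
    IsClosed {x | z x ∈ M.compensatedDemand B i (p x) (v x)} := by
  refine (M.isClosed_setOf_le_utility i hv hz).and ?_
  simp only [Set.ofPred_forall]
  exact isClosed_biInter fun z' _ => isClosed_imp (isOpen_lt hv continuous_const)
    (isClosed_le (by fun_prop) (by fun_prop))

-- Minimizing over the closure avoids the bundles with utility exactly `v` that are not limits of
-- better ones.
theorem inter_compensatedDemand_nonempty (M : MixedMarket A C J S) {B : Set (C ⊕ J → ℝ)}
    (hB : IsCompact B) (hB0 : ∀ z ∈ B, 0 ≤ z) (i : A) (p : C ⊕ J → ℝ) {v : ℝ} {z₀ : C ⊕ J → ℝ}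
    (hz₀ : z₀ ∈ B) (hv : v ≤ M.utility i z₀) : (B ∩ M.compensatedDemand B i p v).Nonempty := by
  rcases {z ∈ B | v < M.utility i z}.eq_empty_or_nonempty with hempty | hne
  · exact ⟨z₀, hz₀, ⟨hB0 z₀ hz₀, hv⟩, fun z' hz' hlt =>
      (Set.eq_empty_iff_forall_notMem.1 hempty z' ⟨hz', hlt⟩).elim⟩
  · have hcl : closure {z ∈ B | v < M.utility i z} ⊆ B ∩ {z | 0 ≤ z ∧ v ≤ M.utility i z} :=
      closure_minimal (fun z hz => ⟨hz.1, hB0 z hz.1, hz.2.le⟩)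
        (hB.isClosed.inter (M.isClosed_setOf_le_utility i continuous_const continuous_id))
    have hcomp := hB.of_isClosed_subset isClosed_closure fun z hz => (hcl hz).1
    obtain ⟨z, hz, hmin⟩ := hcomp.exists_isMinOn hne.closure
      (f := fun z => p ⬝ᵥ z) (by fun_prop)
    exact ⟨z, (hcl hz).1, (hcl hz).2, fun z' hz' hlt => hmin (subset_closure ⟨hz', hlt⟩)⟩

end CompensatedDemand

section FeasibleStates

variable {A C J : Type*} {S : J → Type*} [Fintype C] [Fintype J]

/-- Prices, a utility scale, a coarse allocation and a production. -/
abbrev State (A C J : Type*) :=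
  (C ⊕ J → ℝ) × ℝ × (A → C ⊕ J → ℝ) × (A → C ⊕ J → ℝ)

/-- The states in which the utility scale is at most `αmax` and the bundles are at most `b`. -/
def feasibleStates (M : MixedMarket A C J S) (αmax : ℝ) (b : C ⊕ J → ℝ) : Set (State A C J) :=
  stdSimplex ℝ (C ⊕ J) ×ˢ Set.Icc 0 αmax ×ˢ
    (Set.univ.pi fun _ : A => Set.Icc (0 : C ⊕ J → ℝ) b) ×ˢ Set.univ.pi M.production

theorem isCompact_feasibleStates (M : MixedMarket A C J S) (αmax : ℝ) (b : C ⊕ J → ℝ) :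
    IsCompact (M.feasibleStates αmax b) :=
  (isCompact_stdSimplex ℝ _).prod <| isCompact_Icc.prod <|
    (isCompact_univ_pi fun _ => isCompact_Icc).prod (isCompact_univ_pi M.production_compact)

theorem convex_feasibleStates (M : MixedMarket A C J S) (αmax : ℝ) (b : C ⊕ J → ℝ) :
    Convex ℝ (M.feasibleStates αmax b) :=
  (convex_stdSimplex ℝ _).prod <| (convex_Icc _ _).prod <|
    (convex_pi fun _ _ => convex_Icc _ _).prod (convex_pi fun i _ => M.production_convex i)

theorem feasibleStates_nonempty [Nonempty (C ⊕ J)] (M : MixedMarket A C J S) {αmax : ℝ}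
    (hα : 0 ≤ αmax) {b : C ⊕ J → ℝ} (hb : 0 ≤ b) (hP : ∀ i, (M.production i).Nonempty) :
    (M.feasibleStates αmax b).Nonempty :=
  (Set.nonempty_coe_sort.1 inferInstance).prod <| (Set.nonempty_Icc.2 hα).prod <|
    (Set.univ_pi_nonempty_iff.2 fun _ => Set.nonempty_Icc.2 hb).prod
      (Set.univ_pi_nonempty_iff.2 hP)

end FeasibleStates

section QuasiEquilibrium

variable {A C J : Type*} {S : J → Type*} [Fintype A] [Fintype C] [Fintype J]
  [∀ j, Fintype (S j)] [Nonempty A]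

/-- Equilibrium at the utilities `α • u`, except that each agent minimizes her expenditure among
the bundles of `B` instead of maximizing her utility within her budget. Agents with `u i = 0` are
given nothing. -/
structure IsQuasiEquilibrium (M : MixedMarket A C J S) (u : A → ℝ) (B : Set (C ⊕ J → ℝ))
    (p : C ⊕ J → ℝ) (α : ℝ) (z y : A → C ⊕ J → ℝ) : Prop where
  price_mem : p ∈ stdSimplex ℝ (C ⊕ J)
  production_mem : ∀ i, y i ∈ M.production i
  production_optimal : ∀ i, IsMaxOn (M.profit p z y i) (M.production i) (y i)
  demand_le_supply : demand z ≤ supply S y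
  value_demand : p ⬝ᵥ demand z = p ⬝ᵥ supply S y
  allocation_mem : ∀ i, z i ∈ M.compensatedDemand B i p (α * u i)
  allocation_eq_zero : ∀ i, u i = 0 → z i = 0

theorem IsQuasiEquilibrium.anti {M : MixedMarket A C J S} {u : A → ℝ} {B B' : Set (C ⊕ J → ℝ)}
    {p : C ⊕ J → ℝ} {α : ℝ} {z y : A → C ⊕ J → ℝ} (h : M.IsQuasiEquilibrium u B' p α z y)
    (hB : B ⊆ B') : M.IsQuasiEquilibrium u B p α z y where
  __ := h
  allocation_mem i := M.compensatedDemand_anti hB i p _ (h.allocation_mem i)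

theorem isClosed_setOf_isQuasiEquilibrium (M : MixedMarket A C J S) (u : A → ℝ)
    (B : Set (C ⊕ J → ℝ)) :
    IsClosed {q : State A C J | M.IsQuasiEquilibrium u B q.1 q.2.1 q.2.2.1 q.2.2.2} := by
  have hdemand : Continuous fun q : State A C J => demand q.2.2.1 :=
    continuous_demand.comp (by fun_prop)
  have hsupply : Continuous fun q : State A C J => supply S q.2.2.2 :=
    (continuous_supply S).comp (by fun_prop)
  set Q := {q : State A C J | M.IsQuasiEquilibrium u B q.1 q.2.1 q.2.2.1 q.2.2.2}
  refine isClosed_of_closure_subset fun q hq => ?_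
  have closed_field {P : State A C J → Prop} (hP : IsClosed {q | P q}) (h : ∀ q ∈ Q, P q) : P q :=
    closure_minimal h hP hq
  exact
  { price_mem := closed_field ((isClosed_stdSimplex ℝ (C ⊕ J)).preimage continuous_fst)
      fun _ h => IsQuasiEquilibrium.price_mem h
    production_mem i := closed_field ((M.production_compact i).isClosed.preimage (by fun_prop))
      fun _ h => IsQuasiEquilibrium.production_mem h i
    production_optimal i := closed_field
      (P := fun q => IsMaxOn (M.profit q.1 q.2.2.1 q.2.2.2 i) (M.production i) (q.2.2.2 i))
      (M.isClosed_setOf_isMaxOn_profit i _ (by fun_prop) (by fun_prop) (by fun_prop) (by fun_prop))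
      fun _ h => IsQuasiEquilibrium.production_optimal h i
    demand_le_supply := closed_field (isClosed_le hdemand hsupply)
      fun _ h => IsQuasiEquilibrium.demand_le_supply h
    value_demand := closed_field (isClosed_eq (by fun_prop) (by fun_prop))
      fun _ h => IsQuasiEquilibrium.value_demand h
    allocation_mem i := closed_field
      (M.isClosed_setOf_mem_compensatedDemand B i (by fun_prop) (by fun_prop) (by fun_prop))
      fun _ h => IsQuasiEquilibrium.allocation_mem h i
    allocation_eq_zero i := closed_field
      (isClosed_imp isOpen_const (isClosed_eq (by fun_prop) continuous_const))
      fun _ h => IsQuasiEquilibrium.allocation_eq_zero h i }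

end QuasiEquilibrium

section Reactions

variable {A C J : Type*} {S : J → Type*} [Fintype A] [Fintype C] [Fintype J]
  [∀ j, Fintype (S j)] [Nonempty A]

/-- Prices maximize the value of excess demand, the utility scale minimizes it, consumers choose
compensated demands, and producers respond optimally. The utility levels are cut off at the utility
of the largest bundle `r`, so that compensated demands exist. -/
def reactions (M : MixedMarket A C J S) (u : A → ℝ) (αmax : ℝ) (r p : C ⊕ J → ℝ) (α : ℝ)
    (z y : A → C ⊕ J → ℝ) : Set (State A C J) :=
  {p' ∈ stdSimplex ℝ (C ⊕ J) |
    IsMaxOn (· ⬝ᵥ (demand z - supply S y)) (stdSimplex ℝ (C ⊕ J)) p'} ×ˢ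
  {α' ∈ Set.Icc 0 αmax | IsMinOn (· * (p ⬝ᵥ (demand z - supply S y))) (Set.Icc 0 αmax) α'} ×ˢ
  (Set.univ.pi fun i => {z' ∈ Set.Icc 0 r ∩
    M.compensatedDemand (Set.Icc 0 r) i p (min (α * u i) (M.utility i r)) | u i = 0 → z' = 0}) ×ˢ
  (Set.univ.pi fun i => {y' ∈ M.production i | IsMaxOn (M.profit p z y i) (M.production i) y'})

theorem reactions_subset_feasibleStates (M : MixedMarket A C J S) (u : A → ℝ) (αmax : ℝ)
    (r p : C ⊕ J → ℝ) (α : ℝ) (z y : A → C ⊕ J → ℝ) :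
    M.reactions u αmax r p α z y ⊆ M.feasibleStates αmax r :=
  Set.prod_mono (fun _ h => h.1) <| Set.prod_mono (fun _ h => h.1) <|
    Set.prod_mono (Set.pi_mono fun _ _ _ h => h.1.1) (Set.pi_mono fun _ _ _ h => h.1)

theorem convex_reactions (M : MixedMarket A C J S) (u : A → ℝ) (αmax : ℝ) (r : C ⊕ J → ℝ)
    {p : C ⊕ J → ℝ} (hp : 0 ≤ p) (α : ℝ) (z y : A → C ⊕ J → ℝ) :
    Convex ℝ (M.reactions u αmax r p α z y) := by
  set e := demand z - supply S y
  have hprice : IsLinearMap ℝ (· ⬝ᵥ e : (C ⊕ J → ℝ) → ℝ) :=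
    ⟨fun p₁ p₂ => add_dotProduct p₁ p₂ e, fun t p₁ => smul_dotProduct t p₁ e⟩
  have hscale := (LinearMap.mulRight ℝ (p ⬝ᵥ e)).convexOn (convex_Icc (0 : ℝ) αmax)
  refine Convex.prod ?_ (Convex.prod ?_ (Convex.prod ?_ ?_))
  · exact convex_setOf_isMaxOn
      ((hprice.mk' _).concaveOn (convex_stdSimplex ℝ (C ⊕ J))).quasiconcaveOn
  · exact convex_setOf_isMaxOn hscale.quasiconvexOn.dual
  · refine convex_pi fun i _ => ((convex_Icc 0 r).inter
      (M.convex_compensatedDemand (Set.Icc 0 r) i p _)).inter ?_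
    intro z₁ h₁ z₂ h₂ s t _ _ _ hi
    rw [h₁ hi, h₂ hi, smul_zero, smul_zero, add_zero]
  · exact convex_pi fun i _ => convex_setOf_isMaxOn
      ((M.concaveOn_profit hp z y i).subset (Set.subset_univ _)
        (M.production_convex i)).quasiconcaveOn

theorem reactions_nonempty [Nonempty (C ⊕ J)] (M : MixedMarket A C J S) (u : A → ℝ)
    {αmax : ℝ} (hα : 0 ≤ αmax) {r : C ⊕ J → ℝ} (hr : 0 ≤ r) (hP : ∀ i, (M.production i).Nonempty)
    {p : C ⊕ J → ℝ} (hp : 0 ≤ p) (α : ℝ) (z y : A → C ⊕ J → ℝ) :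
    (M.reactions u αmax r p α z y).Nonempty := by
  refine Set.Nonempty.prod ?_ (Set.Nonempty.prod ?_ (Set.Nonempty.prod ?_ ?_))
  · exact (isCompact_stdSimplex ℝ (C ⊕ J)).exists_isMaxOn
      (Set.nonempty_coe_sort.1 inferInstance) (by fun_prop)
  · exact isCompact_Icc.exists_isMinOn (Set.nonempty_Icc.2 hα) (by fun_prop)
  · refine Set.univ_pi_nonempty_iff.2 fun i => ?_
    by_cases hi : u i = 0
    · refine ⟨0, ⟨⟨le_rfl, hr⟩, ⟨le_rfl, ?_⟩, fun z' hz' _ => ?_⟩, fun _ => rfl⟩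
      · rw [hi, mul_zero]
        exact (min_le_left _ _).trans (M.utility_nonneg i 0 le_rfl)
      · rw [dotProduct_zero]
        exact dotProduct_nonneg_of_nonneg hp hz'.1
    · obtain ⟨z', hz'⟩ := M.inter_compensatedDemand_nonempty isCompact_Icc (fun _ h => h.1) i p
        (Set.right_mem_Icc.2 hr) (min_le_right (α * u i) (M.utility i r))
      exact ⟨z', hz', fun h => absurd h hi⟩
  · exact Set.univ_pi_nonempty_iff.2 fun i => (M.production_compact i).exists_isMaxOn (hP i)
      (M.continuous_profit i continuous_const continuous_const continuous_const
        continuous_id).continuousOn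

theorem isClosed_graph_reactions (M : MixedMarket A C J S) (u : A → ℝ) (αmax : ℝ)
    (r : C ⊕ J → ℝ) : IsClosed {q : State A C J × State A C J |
      q.2 ∈ M.reactions u αmax r q.1.1 q.1.2.1 q.1.2.2.1 q.1.2.2.2} := by
  have hexcess : Continuous fun q : State A C J × State A C J =>
      demand q.1.2.2.1 - supply S q.1.2.2.2 :=
    (continuous_demand.comp (by fun_prop)).sub ((continuous_supply S).comp (by fun_prop))
  simp only [reactions, Set.mem_prod, Set.mem_pi, Set.mem_univ, true_implies, Set.mem_inter_iff,
    Set.mem_ofPred_eq, Set.ofPred_and, Set.ofPred_forall]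
  refine .inter (.inter ?_ ?_) (.inter (.inter ?_ ?_) (.inter (isClosed_iInter fun i =>
    .inter (.inter ?_ ?_) ?_) (isClosed_iInter fun i => .inter ?_ ?_)))
  · exact (isClosed_stdSimplex ℝ (C ⊕ J)).preimage (by fun_prop)
  · exact isClosed_setOf_isMaxOn
      (f := fun q : State A C J × State A C J => (· ⬝ᵥ (demand q.1.2.2.1 - supply S q.1.2.2.2)))
      (fun _ _ => by fun_prop) (by fun_prop)
  · exact isClosed_Icc.preimage (by fun_prop)
  · exact isClosed_setOf_isMinOn (f := fun q : State A C J × State A C J =>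
      (· * (q.1.1 ⬝ᵥ (demand q.1.2.2.1 - supply S q.1.2.2.2))))
      (fun _ _ => by fun_prop) (by fun_prop)
  · exact isClosed_Icc.preimage (by fun_prop)
  · exact M.isClosed_setOf_mem_compensatedDemand _ i (by fun_prop) (by fun_prop) (by fun_prop)
  · exact (isClosed_iInter fun _ => isClosed_eq continuous_id continuous_const).preimage
      (by fun_prop)
  · exact (M.production_compact i).isClosed.preimage (by fun_prop)
  · exact M.isClosed_setOf_isMaxOn_profit i (M.production i) (by fun_prop) (by fun_prop)
      (by fun_prop) (by fun_prop)

end Reactions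

section Existence

variable {A C J : Type*} {S : J → Type*} [Fintype A] [Fintype C] [Fintype J]
  [∀ j, Fintype (S j)] [Nonempty A]

-- If excess demand had positive value, then the scale would be `0`, and everyone could afford the
-- conventional allocation.
theorem dotProduct_excess_nonpos_of_mem_reactions (M : MixedMarket A C J S) {u : A → ℝ}
    (hu : M.AttainedConventionally u) {αmax : ℝ} (hαmax : 0 ≤ αmax) {r : C ⊕ J → ℝ} (hr : 0 ≤ r)
    (hsupply : ∀ y : A → C ⊕ J → ℝ, (∀ i, y i ∈ M.production i) → supply S y ≤ r)
    {p : C ⊕ J → ℝ} {α : ℝ} {z y : A → C ⊕ J → ℝ}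
    (h : (p, α, z, y) ∈ M.reactions u αmax r p α z y) :
    p ⬝ᵥ (demand z - supply S y) ≤ 0 := by
  obtain ⟨y₀, z₀, hy₀, -, hz₀, hz₀J, hclear, hu⟩ := hu
  obtain ⟨⟨hp, -⟩, ⟨hα, hαmin⟩, hz, hy⟩ := h
  by_contra! hpos
  have hα0 : α = 0 := by
    refine le_antisymm (le_of_mul_le_mul_right ?_ hpos) hα.1
    exact hαmin (Set.left_mem_Icc.2 hαmax)
  have hz₀r : ∀ i, z₀ i ≤ r := by
    rintro i (c | j)
    · exact (le_demand hz₀ i (Sum.inl c)).trans ((hclear c).le.trans (hsupply y₀ hy₀ (Sum.inl c)))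
    · exact (hz₀J i j).le.trans (hr _)
  have hcheap : ∀ i, p ⬝ᵥ z i ≤ p ⬝ᵥ z₀ i := by
    intro i
    by_cases hi : u i = 0
    · have hzi : z i = 0 := (hz i trivial).2 hi
      rw [hzi, dotProduct_zero]
      exact dotProduct_nonneg_of_nonneg hp.1 (hz₀ i)
    · refine (hz i trivial).1.2.2 (z₀ i) ⟨hz₀ i, hz₀r i⟩ ((min_le_left _ _).trans_lt ?_)
      rw [hα0, zero_mul, ← hu i]
      exact (Ne.symm hi).lt_of_le (hu i ▸ M.utility_nonneg i _ (hz₀ i))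
  have hvalue := M.sum_dotProduct_conventional_le hp.1 (fun i => (hz i trivial).1.1.1)
    (fun i => M.production_nonneg i _ (hy i trivial).1) (fun i => (hy i trivial).2) hy₀ hz₀J hclear
  exact hpos.not_ge <| (dotProduct_demand_sub_supply_le hp.1 z y).trans <|
    sub_nonpos.2 ((Finset.sum_le_sum fun i _ => hcheap i).trans hvalue)

theorem demand_le_supply_of_mem_reactions (M : MixedMarket A C J S) {u : A → ℝ} {αmax : ℝ}
    {r p : C ⊕ J → ℝ} {α : ℝ} {z y : A → C ⊕ J → ℝ}
    (h : (p, α, z, y) ∈ M.reactions u αmax r p α z y)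
    (hvalue : p ⬝ᵥ (demand z - supply S y) ≤ 0) : demand z ≤ supply S y := fun a =>
  sub_nonpos.1 ((le_dotProduct_of_isMaxOn_stdSimplex h.1.2 a).trans hvalue)

theorem isQuasiEquilibrium_of_mem_reactions (M : MixedMarket A C J S) {u : A → ℝ} {i₀ : A}
    (hi₀ : 0 < u i₀) {r p : C ⊕ J → ℝ} (hr : 0 ≤ r) {α : ℝ} {z y : A → C ⊕ J → ℝ}
    (h : (p, α, z, y) ∈ M.reactions u (M.utility i₀ r / u i₀) r p α z y)
    (hvalue : p ⬝ᵥ (demand z - supply S y) ≤ 0)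
    (hlt : ∀ i, M.utility i (z i) < M.utility i r) :
    M.IsQuasiEquilibrium u (Set.Icc 0 r) p α z y := by
  have hdemand := M.demand_le_supply_of_mem_reactions h hvalue
  obtain ⟨⟨hp, -⟩, ⟨-, hαmin⟩, hz, hy⟩ := h
  have hmem : ∀ i, z i ∈ M.compensatedDemand (Set.Icc 0 r) i p (α * u i) := fun i => by
    have hmem := (hz i trivial).1.2
    rcases min_le_iff.1 hmem.1.2 with hi | hi
    · rwa [min_eq_left (hi.trans (hlt i).le)] at hmem
    · exact absurd hi (hlt i).not_ge
  have hvalue0 : p ⬝ᵥ (demand z - supply S y) = 0 := by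
    refine hvalue.antisymm (not_lt.1 fun hneg => (hlt i₀).not_ge ?_)
    have hαmax : M.utility i₀ r / u i₀ ≤ α := (mul_le_mul_right_of_neg hneg).1
      (hαmin (Set.right_mem_Icc.2 (div_nonneg (M.utility_nonneg i₀ r hr) hi₀.le)))
    exact ((div_le_iff₀ hi₀).1 hαmax).trans (hmem i₀).1.2
  exact
  { price_mem := hp
    production_mem i := (hy i trivial).1
    production_optimal i := (hy i trivial).2
    demand_le_supply := hdemand
    value_demand := sub_eq_zero.1 (by rwa [← dotProduct_sub])
    allocation_mem := hmem
    allocation_eq_zero i := (hz i trivial).2 }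

theorem exists_isQuasiEquilibrium_Icc [Nonempty (C ⊕ J)] (M : MixedMarket A C J S) {u : A → ℝ}
    (hu : M.AttainedConventionally u) {i₀ : A} (hi₀ : 0 < u i₀) {b r : C ⊕ J → ℝ} (hb : 0 ≤ b)
    (hsupply : ∀ y : A → C ⊕ J → ℝ, (∀ i, y i ∈ M.production i) → supply S y ≤ b)
    (hbr : b ≤ r) (hU : ∀ i, M.utility i b < M.utility i r) :
    ∃ q ∈ M.feasibleStates (M.utility i₀ b / u i₀) b,
      M.IsQuasiEquilibrium u (Set.Icc 0 r) q.1 q.2.1 q.2.2.1 q.2.2.2 := by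
  have hr : 0 ≤ r := hb.trans hbr
  have hαmax : 0 ≤ M.utility i₀ r / u i₀ := div_nonneg (M.utility_nonneg i₀ r hr) hi₀.le
  have hP : ∀ i, (M.production i).Nonempty := fun i => ⟨_, hu.choose_spec.choose_spec.1 i⟩
  obtain ⟨⟨p, α, z, y⟩, -, hfix⟩ := exists_mem_self_of_isClosed_graph
    (M.isCompact_feasibleStates (M.utility i₀ r / u i₀) r) (M.convex_feasibleStates _ r)
    (M.feasibleStates_nonempty hαmax hr hP)
    (F := fun q => M.reactions u (M.utility i₀ r / u i₀) r q.1 q.2.1 q.2.2.1 q.2.2.2)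
    (fun q _ => M.reactions_subset_feasibleStates u _ r _ _ _ _)
    (fun q hq => M.reactions_nonempty u hαmax hr hP hq.1.1 _ _ _)
    (fun q hq => M.convex_reactions u _ r hq.1.1 _ _ _)
    (((M.isCompact_feasibleStates _ r).isClosed.preimage continuous_fst).inter
      (M.isClosed_graph_reactions u _ r))
  have hvalue := M.dotProduct_excess_nonpos_of_mem_reactions hu hαmax hr
    (fun y hy => (hsupply y hy).trans hbr) hfix
  have hz : ∀ i, 0 ≤ z i := fun i => (hfix.2.2.1 i trivial).1.1.1
  have hzb : ∀ i, z i ≤ b := fun i => (le_demand hz i).trans <|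
    (M.demand_le_supply_of_mem_reactions hfix hvalue).trans <|
      hsupply y fun i => (hfix.2.2.2 i trivial).1
  have hq := M.isQuasiEquilibrium_of_mem_reactions hi₀ hr hfix hvalue fun i =>
    (M.utility_mono i (hz i) (hzb i)).trans_lt (hU i)
  have hα : α ≤ M.utility i₀ b / u i₀ := (le_div_iff₀ hi₀).2 <|
    (hq.allocation_mem i₀).1.2.trans (M.utility_mono i₀ (hz i₀) (hzb i₀))
  exact ⟨_, ⟨hq.price_mem, ⟨hfix.2.1.1.1, hα⟩, fun i _ => ⟨hz i, hzb i⟩,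
    fun i _ => hq.production_mem i⟩, hq⟩

-- The feasible states do not depend on the box, so compactness allows to pass to all bundles.
theorem exists_isQuasiEquilibrium_Ici [Nonempty (C ⊕ J)] (M : MixedMarket A C J S) {u : A → ℝ}
    (hu : M.AttainedConventionally u) (hpos : ∃ i, 0 < u i) :
    ∃ p α z y, M.IsQuasiEquilibrium u (Set.Ici 0) p α z y := by
  obtain ⟨i₀, hi₀⟩ := hpos
  obtain ⟨b, hb, hsupply⟩ := M.exists_supply_le
  obtain ⟨r, hbr, hU⟩ := M.exists_le_forall_utility_lt hb
  have hr : 0 ≤ r := hb.trans hbr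
  let Q : (C ⊕ J → ℝ) → Set (State A C J) := fun w =>
    M.feasibleStates (M.utility i₀ b / u i₀) b ∩
      {q | M.IsQuasiEquilibrium u (Set.Icc 0 (r ⊔ w)) q.1 q.2.1 q.2.2.1 q.2.2.2}
  have hcompact : ∀ w, IsCompact (Q w) := fun w =>
    (M.isCompact_feasibleStates _ b).inter_right (M.isClosed_setOf_isQuasiEquilibrium u _)
  have hanti : Antitone Q := fun w w' hw q hq =>
    ⟨hq.1, hq.2.anti (Set.Icc_subset_Icc_right (sup_le_sup_left hw r))⟩
  have hne : ∀ w, (Q w).Nonempty := fun w =>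
    M.exists_isQuasiEquilibrium_Icc hu hi₀ hb hsupply (hbr.trans le_sup_left) fun i =>
      (hU i).trans_le (M.utility_mono i hr le_sup_left)
  obtain ⟨q, hq⟩ := IsCompact.nonempty_iInter_of_directed_nonempty_isCompact_isClosed Q
    hanti.directed_ge hne hcompact fun w => (hcompact w).isClosed
  have hq : ∀ w, M.IsQuasiEquilibrium u (Set.Icc 0 (r ⊔ w)) q.1 q.2.1 q.2.2.1 q.2.2.2 := fun w =>
    (Set.mem_iInter.1 hq w).2
  exact ⟨q.1, q.2.1, q.2.2.1, q.2.2.2,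
    { hq 0 with
      allocation_mem i := ⟨((hq 0).allocation_mem i).1, fun w hw =>
        ((hq w).allocation_mem i).2 w ⟨hw, le_sup_right⟩⟩ }⟩

end Existence

end MixedMarket

namespace MixedMarket.IsQuasiEquilibrium

variable {A C J : Type*} {S : J → Type*} [Fintype A] [Fintype C] [Fintype J]
  [∀ j, Fintype (S j)] [Nonempty A] {M : MixedMarket A C J S} {u : A → ℝ} {p : C ⊕ J → ℝ} {α : ℝ}
  {z y : A → C ⊕ J → ℝ}

section MarketClearing

variable {B : Set (C ⊕ J → ℝ)}

theorem allocation_nonneg (h : M.IsQuasiEquilibrium u B p α z y) : 0 ≤ z := fun i =>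
  (h.allocation_mem i).1.1

theorem production_nonneg (h : M.IsQuasiEquilibrium u B p α z y) : 0 ≤ y := fun i =>
  M.production_nonneg i _ (h.production_mem i)

theorem allocation_le_supply (h : M.IsQuasiEquilibrium u B p α z y) (i : A) : z i ≤ supply S y :=
  (le_demand h.allocation_nonneg i).trans h.demand_le_supply

theorem mul_demand_eq_mul_supply (h : M.IsQuasiEquilibrium u B p α z y) (a : C ⊕ J) :
    p a * demand z a = p a * supply S y a :=
  (Finset.sum_eq_sum_iff_of_le fun a _ =>
    mul_le_mul_of_nonneg_left (h.demand_le_supply a) (h.price_mem.1 a)).1 h.value_demand a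
    (Finset.mem_univ a)

theorem demand_eq_supply (h : M.IsQuasiEquilibrium u B p α z y) {a : C ⊕ J} (ha : 0 < p a) :
    demand z a = supply S y a :=
  mul_left_cancel₀ ha.ne' (h.mul_demand_eq_mul_supply a)

theorem exists_eq_supply (h : M.IsQuasiEquilibrium u B p α z y) {j : J} (hj : 0 < p (Sum.inr j)) :
    ∃ i, z i (Sum.inr j) = supply S y (Sum.inr j) := by
  obtain ⟨i, -, hi⟩ := Finset.exists_mem_eq_sup' Finset.univ_nonempty fun i => z i (Sum.inr j)
  exact ⟨i, hi.symm.trans (h.demand_eq_supply hj)⟩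

theorem sum_dotProduct_eq_totalSales (h : M.IsQuasiEquilibrium u B p α z y) :
    ∑ i, p ⬝ᵥ z i = totalSales S p z y := by
  rw [← dotProduct_sum, dotProduct, Fintype.sum_sum_type, totalSales]
  simp only [← h.mul_demand_eq_mul_supply (Sum.inl _), demand, Finset.sum_apply,
    min_eq_left (h.allocation_le_supply _ _)]

theorem exists_dotProduct_pos [∀ j, Nonempty (S j)] (h : M.IsQuasiEquilibrium u B p α z y) :
    ∃ i, 0 < p ⬝ᵥ z i := by
  have hp : 0 ≤ p := h.price_mem.1
  obtain ⟨a, -, ha⟩ : ∃ a ∈ Finset.univ, 0 < p a :=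
    Finset.exists_lt_of_sum_lt (by simp [h.price_mem.2])
  rcases a with c | j
  · have hpos := M.totalSales_pos hp h.allocation_nonneg h.production_nonneg
      h.production_optimal ha
    rw [← h.sum_dotProduct_eq_totalSales] at hpos
    obtain ⟨i, -, hi⟩ : ∃ i ∈ Finset.univ, 0 < p ⬝ᵥ z i :=
      Finset.exists_lt_of_sum_lt (by simpa using hpos)
    exact ⟨i, hi⟩
  · obtain ⟨i, hi⟩ := h.exists_eq_supply ha
    have hsupply : 0 < supply S y (Sum.inr j) :=
      Finset.sum_pos' (fun k _ => available_nonneg h.production_nonneg j k)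
        ⟨Sum.inl (Classical.arbitrary (S j)), Finset.mem_univ _, zero_lt_one⟩
    exact ⟨i, Finset.sum_pos' (fun a _ => mul_nonneg (hp a) (h.allocation_nonneg i a))
      ⟨Sum.inr j, Finset.mem_univ _, mul_pos ha (hi ▸ hsupply)⟩⟩

end MarketClearing

section UtilityMaximization

theorem dotProduct_lt (h : M.IsQuasiEquilibrium u (Set.Ici 0) p α z y) {i : A}
    {z' : C ⊕ J → ℝ} (hz' : 0 ≤ z') (hlt : α * u i < M.utility i z') (hpos : 0 < p ⬝ᵥ z') :
    p ⬝ᵥ z i < p ⬝ᵥ z' := by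
  obtain ⟨z'', hz'', hlt', hcheaper⟩ := M.exists_lt_utility_dotProduct_lt i hz' hlt hpos
  exact ((h.allocation_mem i).2 z'' hz'' hlt').trans_lt hcheaper

variable [∀ j, Nonempty (S j)]

-- An agent with positive wealth could improve on her bundle for free if some good were free.
theorem price_pos (h : M.IsQuasiEquilibrium u (Set.Ici 0) p α z y) (a : C ⊕ J) : 0 < p a := by
  classical
  refine (h.price_mem.1 a).lt_of_ne fun ha => ?_
  obtain ⟨i, hi⟩ := h.exists_dotProduct_pos
  obtain ⟨t, ht, hU⟩ := M.exists_lt_utility_update i (h.allocation_nonneg i) a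
  have hcost : p ⬝ᵥ Function.update (z i) a t = p ⬝ᵥ z i := by
    refine Finset.sum_congr rfl fun b _ => ?_
    rcases eq_or_ne b a with rfl | hb
    · rw [← ha, zero_mul, zero_mul]
    · rw [Function.update_of_ne hb]
  have hlt := h.dotProduct_lt ((h.allocation_nonneg i).trans (le_update_self_iff.2 ht.le))
    ((h.allocation_mem i).1.2.trans_lt hU) (hcost.symm ▸ hi)
  exact hlt.ne' hcost

theorem utility_le_of_dotProduct_le (h : M.IsQuasiEquilibrium u (Set.Ici 0) p α z y) (i : A)
    {z' : C ⊕ J → ℝ} (hz' : 0 ≤ z') (hle : p ⬝ᵥ z' ≤ p ⬝ᵥ z i) :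
    M.utility i z' ≤ M.utility i (z i) := by
  rcases lt_or_ge 0 (p ⬝ᵥ z') with hpos | hnonpos
  · by_contra! hlt
    exact (h.dotProduct_lt hz' ((h.allocation_mem i).1.2.trans_lt hlt) hpos).not_ge hle
  · rw [eq_zero_of_dotProduct_nonpos h.price_pos hz' hnonpos]
    exact M.utility_mono i le_rfl (h.allocation_nonneg i)

-- If `α < 1`, then the conventional allocation is better for everyone, hence more expensive than
-- `z`, although the sales at the quasi-equilibrium suffice to pay for it.
theorem one_le_scale (h : M.IsQuasiEquilibrium u (Set.Ici 0) p α z y)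
    (hu : M.AttainedConventionally u) : 1 ≤ α := by
  obtain ⟨y₀, z₀, hy₀, -, hz₀, hz₀J, hclear, hu⟩ := hu
  have hp : 0 ≤ p := h.price_mem.1
  by_contra! hα
  have hbetter : ∀ i, u i ≠ 0 → α * u i < M.utility i (z₀ i) := fun i hi =>
    (mul_lt_of_lt_one_left ((hu i ▸ M.utility_nonneg i _ (hz₀ i)).lt_of_ne hi.symm) hα).trans_eq
      (hu i)
  have hle : ∀ i, p ⬝ᵥ z i ≤ p ⬝ᵥ z₀ i := fun i => by
    by_cases hi : u i = 0
    · rw [h.allocation_eq_zero i hi, dotProduct_zero]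
      exact dotProduct_nonneg_of_nonneg hp (hz₀ i)
    · exact (h.allocation_mem i).2 _ (hz₀ i) (hbetter i hi)
  obtain ⟨i, hi⟩ := h.exists_dotProduct_pos
  have hui : u i ≠ 0 := fun hui => by
    rw [h.allocation_eq_zero i hui, dotProduct_zero] at hi
    exact hi.false
  have hlt : p ⬝ᵥ z i < p ⬝ᵥ z₀ i :=
    h.dotProduct_lt (hz₀ i) (hbetter i hui) (hi.trans_le (hle i))
  refine (Finset.sum_lt_sum (fun i _ => hle i) ⟨i, Finset.mem_univ i, hlt⟩).not_ge ?_
  rw [h.sum_dotProduct_eq_totalSales]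
  exact M.sum_dotProduct_conventional_le hp h.allocation_nonneg h.production_nonneg
    h.production_optimal hy₀ hz₀J hclear

theorem utility_eq (h : M.IsQuasiEquilibrium u (Set.Ici 0) p α z y)
    (hu : M.AttainedConventionally u) (i : A) : M.utility i (z i) = α * u i := by
  refine le_antisymm ?_ (h.allocation_mem i).1.2
  rcases lt_or_ge 0 (p ⬝ᵥ z i) with hpos | hnonpos
  · by_contra! hlt
    exact (h.dotProduct_lt (h.allocation_nonneg i) hlt hpos).false
  · have hα := h.one_le_scale hu
    obtain ⟨-, z₀, -, -, hz₀, -, -, hu⟩ := hu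
    rw [eq_zero_of_dotProduct_nonpos h.price_pos (h.allocation_nonneg i) hnonpos, hu i]
    exact (M.utility_mono i le_rfl (hz₀ i)).trans
      (le_mul_of_one_le_left (M.utility_nonneg i _ (hz₀ i)) hα)

theorem isEquilibriumWithTransfers (h : M.IsQuasiEquilibrium u (Set.Ici 0) p α z y) :
    M.IsEquilibriumWithTransfers (fun i => p ⬝ᵥ z i) p z
      (fun i j k => M.detailed y i j (z i (Sum.inr j)) k) y where
  price_nonneg := h.price_mem.1
  transfer_nonneg i := dotProduct_nonneg_of_nonneg h.price_mem.1 (h.allocation_nonneg i)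
  transfer_sum := by
    rw [M.sum_earnings p h.allocation_nonneg h.production_nonneg
      fun i j => h.allocation_le_supply i (Sum.inr j), h.sum_dotProduct_eq_totalSales]
  production_mem := h.production_mem
  production_optimal i y' hy' := by
    simp only [M.earnings_eq_profit_add p h.allocation_nonneg h.production_nonneg
      fun i j => h.allocation_le_supply i (Sum.inr j)]
    gcongr
    exact h.production_optimal i hy'
  allocation_nonneg := h.allocation_nonneg
  allocation_spends _ := rfl
  allocation_optimal i _ := h.utility_le_of_dotProduct_le i
  allocation_detailed _ _ _ := rfl
  conventional_clears c := h.demand_eq_supply (h.price_pos (Sum.inl c))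
  digital_sold j hj k := by
    obtain ⟨i, hi⟩ := h.exists_eq_supply hj
    exact ⟨i, M.detailed_of_supply_le h.production_nonneg i hi.ge k⟩
  digital_available i j := h.allocation_le_supply i (Sum.inr j)

end UtilityMaximization

end MixedMarket.IsQuasiEquilibrium

theorem mainTheorem3 {A C J : Type*} {S : J → Type*} [Fintype A] [Fintype C] [Nonempty C]
    [Fintype J] [∀ j, Fintype (S j)] [∀ j, Nonempty (S j)]
    (M : MixedMarket A C J S) (u : A → ℝ)
    (hu : M.AttainedConventionally u) (hpos : ∃ i, 0 < u i) :
    ∃ (w : A → ℝ) (α : ℝ), 1 ≤ α ∧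
      ∃ (p : C ⊕ J → ℝ) (z : A → C ⊕ J → ℝ) (x : A → ∀ j : J, S j ⊕ A → ℝ)
        (y : A → C ⊕ J → ℝ),
        M.IsEquilibriumWithTransfers w p z x y ∧ ∀ i, M.utility i (z i) = α * u i := by
  have : Nonempty A := ⟨hpos.choose⟩
  obtain ⟨p, α, z, y, h⟩ := M.exists_isQuasiEquilibrium_Ici hu hpos
  exact ⟨_, α, h.one_le_scale hu, p, z, _, y, h.isEquilibriumWithTransfers, h.utility_eq hu⟩
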